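/- **Proposition (Approximated Gaussian Mixture Fisher–Rao Parameter Flow).** Let $p(x)>0$ be a prior density on $\mathbb{R}^n$, let $p(z\mid x)>0$ be a likelihood at a fixed measurement $z$, let the joint density $x\mapsto p(x,z)=p(z\mid x)p(x)$ be $C^2$ and integrable, and let $p(x\mid z)=p(x,z)/\int p(x',z)\,dx'$ be the posterior density. For $K\ge 1$ consider the Gaussian mixtures $$q(x;\eta)=\sum_{k=1}^K q(x\mid\omega=k;\eta)\,q(\omega=k;\eta),\qquad q(x\mid\omega=k;\eta)=p_{\mathcal N}(x;\mu^{(k)},\Sigma^{(k)}),\quad q(\omega=k;\eta)=\pi^{(k)}>0,\ \ \sum_{k}\pi^{(k)}=1,$$ with $\Sigma^{(k)}\succ0$, in the natural parameters $\eta$ consisting of $$\gamma^{(k)}=[\Sigma^{(k)}]^{-1}\mu^{(k)},\qquad \Gamma^{(k)}=-\tfrac12[\Sigma^{(k)}]^{-1}\ \text{(symmetric)},\qquad \eta_\omega^{(k)}=\log\frac{\pi^{(k)}}{\pi^{(K)}},$$ where $\eta_\omega^{(K)}\equiv0$, so that the free log-odds are $\eta_\omega=(\eta_\omega^{(1)},\dots,\eta_\omega^{(K-1)})$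 and $\pi^{(k)}=e^{\eta^{(k)}_\omega}/\sum_{j=1}^K e^{\eta_\omega^{(j)}}$; a symmetric matrix is parametrized by its entries on and above the diagonal. The Fisher information matrix (FIM) of a parametric density is $\mathcal I(\theta)=\mathbb E_{p(\cdot;\theta)}[\nabla_\theta\log p\,\nabla_\theta^\top\log p]$. Let the approximated FIM $\tilde{\mathcal I}(\eta)$ of the mixture be the FIM of the joint density $q(x,\omega;\eta)=q(x\mid\omega;\eta)q(\omega;\eta)$ of state and component label, and let $$V(x;\eta)=\log q(x;\eta)-\log p(x,z),\qquad D_{KL}(q\,\|\,p)=\int q(x)\log\frac{q(x)}{p(x)}\,dx .$$ Let $\Theta$ be an open set of such parameters $\eta$ such that, for all $\eta\in\Theta$ and all $k$, the functions $\log p(x,z)$, $\nabla_x\log p(x,z)$, $\nabla_x^2\log p(x,z)$ have finite expectations under $q(x\mid\omega=k;\eta)$. Then: 1. For $\eta\in\Theta$, the entries of $\tilde{\mathcal I}(\eta)$ are absolutely convergent integrals and $\tilde{\mathcal I}(\eta)$ is positive definite; the integral defining $D_{KL}(q(\cdot;\eta)\,\|\,p(\cdot\mid z))$ converges absolutely and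 is differentiable in $\eta$ on $\Theta$; $V(\cdot;\eta)$ is $C^2$, and $V,\nabla_xV,\nabla_x^2V$ have finite expectations under every component. 2. For $\eta\in\Theta$, $\tilde{\mathcal I}(\eta)$ is block diagonal: $$\tilde{\mathcal I}(\eta)=\operatorname{diag}\big(\pi^{(1)}\mathcal I(\gamma^{(1)},\Gamma^{(1)}),\dots,\pi^{(K)}\mathcal I(\gamma^{(K)},\Gamma^{(K)}),\ \mathcal I(\eta_\omega)\big),$$ where $\mathcal I(\gamma^{(k)},\Gamma^{(k)})$ is the FIM of the Gaussian $q(x\mid\omega=k)$ and $\mathcal I(\eta_\omega)$ is the FIM of the multinomial distribution $q(\omega)$ in its log-odds. 3. Let $t\mapsto\eta_t$ be a curve of parameters on a set of times and let $t$ be a time with $\eta_t\in\Theta$. Then the natural-gradient flow equation $$\frac{d\eta_t}{dt}=-\tilde{\mathcal I}^{-1}(\eta_t)\,\nabla_{\eta_t}D_{KL}\big(q(x;\eta_t)\,\|\,p(x\mid z)\big)$$ holds at $t$ if and only if, for every $k=1,\dots,K$, $$\begin{aligned} \frac{d\gamma^{(k)}_t}{dt}&=-\mathbb E_{q(x\mid\omega=k;\eta_t)}\Big[\tfrac12\nabla_x^2V(x;\eta_t)\,[\Gamma^{(k)}_t]^{-1}\gamma^{(k)}_t+\nabla_xV(x;\eta_t)\Big],\\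 \frac{d\Gamma^{(k)}_t}{dt}&=-\tfrac12\,\mathbb E_{q(x\mid\omega=k;\eta_t)}\big[\nabla_x^2V(x;\eta_t)\big],\\ \frac{d[\eta^{(k)}_\omega]_t}{dt}&=\mathbb E_{q(x\mid\omega=K;\eta_t)}[V(x;\eta_t)]-\mathbb E_{q(x\mid\omega=k;\eta_t)}[V(x;\eta_t)]. \end{aligned}$$ -/

import Mathlib

open MeasureTheory
open scoped Matrix

noncomputable section

namespace GMFlow

/-- The state space `ℝⁿ` with its Euclidean norm. -/
abbrev Vec (n : ℕ) : Type := EuclideanSpace ℝ (Fin n)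

/-! ### Fisher information -/

/-- The Fisher information matrix at `θ` of a parametric family of densities `p θ` with respect
to a base measure `ν`: the `(a, b)` entry is `E_{p θ} [∂_a log (p θ) · ∂_b log (p θ)]`. -/
def fisherInfo {Ω ι : Type*} [MeasurableSpace Ω] [Fintype ι] [DecidableEq ι]
    (ν : Measure Ω) (p : (ι → ℝ) → Ω → ℝ) (θ : ι → ℝ) : Matrix ι ι ℝ :=
  Matrix.of fun a b => ∫ y, p θ y *
    (fderiv ℝ (fun θ' => Real.log (p θ' y)) θ (Pi.single a 1) *
      fderiv ℝ (fun θ' => Real.log (p θ' y)) θ (Pi.single b 1)) ∂ν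

/-! ### A Gaussian in natural parameters -/

/-- The density of the Gaussian with mean `μ` and covariance `S`. -/
def gaussPDF {n : ℕ} (μ : Fin n → ℝ) (S : Matrix (Fin n) (Fin n) ℝ) (x : Vec n) : ℝ :=
  (Real.sqrt ((2 * Real.pi) ^ n * S.det))⁻¹ *
    Real.exp (-(1 / 2) * ((fun i => x i - μ i) ⬝ᵥ (S⁻¹ *ᵥ fun i => x i - μ i)))

/-- Coordinates for the natural parameters `(γ, Γ)` of one Gaussian: the entries of `γ` and the
entries on and above the diagonal of the symmetric matrix `Γ`. -/
abbrev GIndex (n : ℕ) : Type := Fin n ⊕ {p : Fin n × Fin n // p.1 ≤ p.2}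

abbrev GParam (n : ℕ) : Type := GIndex n → ℝ

/-- The natural parameter `γ = Σ⁻¹ μ`. -/
def GParam.gam {n : ℕ} (θ : GParam n) : Fin n → ℝ := fun i => θ (Sum.inl i)

/-- The natural parameter `Γ = -½ Σ⁻¹`, a symmetric matrix. -/
def GParam.Gam {n : ℕ} (θ : GParam n) : Matrix (Fin n) (Fin n) ℝ :=
  Matrix.of fun i j => θ (Sum.inr ⟨(min i j, max i j), min_le_max⟩)

/-- The covariance `Σ = (-2 Γ)⁻¹`. -/
def GParam.cov {n : ℕ} (θ : GParam n) : Matrix (Fin n) (Fin n) ℝ := ((-2 : ℝ) • θ.Gam)⁻¹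

/-- The mean `μ = Σ γ`. -/
def GParam.mean {n : ℕ} (θ : GParam n) : Fin n → ℝ := θ.cov *ᵥ θ.gam

/-- The Gaussian density as a function of its natural parameters. -/
def natGauss {n : ℕ} (θ : GParam n) (x : Vec n) : ℝ := gaussPDF θ.mean θ.cov x

/-! ### Component weights in log-odds

There are `K = m + 1` components, indexed by `Fin (m + 1)`; the last one is the reference
component, whose log-odds are identically zero. -/

/-- All `m + 1` log-odds `log (π_k / π_K)`, from the `m` free ones. -/
def logOdds {m : ℕ} (w : Fin m → ℝ) (k : Fin (m + 1)) : ℝ :=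
  Fin.lastCases (motive := fun _ => ℝ) 0 w k

/-- The weight `π_k = q(ω = k)`. -/
def weight {m : ℕ} (w : Fin m → ℝ) (k : Fin (m + 1)) : ℝ :=
  Real.exp (logOdds w k) / ∑ j, Real.exp (logOdds w j)

/-! ### The Gaussian mixture -/

/-- Coordinates for the natural parameters of a mixture of `m + 1` Gaussians on `ℝⁿ`. -/
abbrev MIndex (n m : ℕ) : Type := (GIndex n × Fin (m + 1)) ⊕ Fin m

abbrev MParam (n m : ℕ) : Type := MIndex n m → ℝ

/-- The natural parameters `(γ, Γ)` of the `k`th component. -/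
def MParam.comp {n m : ℕ} (η : MParam n m) (k : Fin (m + 1)) : GParam n :=
  fun a => η (Sum.inl (a, k))

/-- The free log-odds. -/
def MParam.odds {n m : ℕ} (η : MParam n m) : Fin m → ℝ := fun k => η (Sum.inr k)

/-- The parameters for which every covariance is (well defined and) positive definite. -/
def admissible (n m : ℕ) : Set (MParam n m) := {η | ∀ k, (-(η.comp k).Gam).PosDef}

/-- The joint density `q(x, ω; η) = q(x | ω; η) q(ω; η)` of the state and the component label,
with respect to Lebesgue measure times counting measure. -/
def jointQ {n m : ℕ} (η : MParam n m) (y : Vec n × Fin (m + 1)) : ℝ :=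
  natGauss (η.comp y.2) y.1 * weight η.odds y.2

/-- The mixture density `q(x; η) = ∑ₖ q(x | ω = k) q(ω = k)`. -/
def mixture {n m : ℕ} (η : MParam n m) (x : Vec n) : ℝ := ∑ k, jointQ η (x, k)

/-- The approximated Fisher information matrix of the mixture: the Fisher information matrix of
the joint density `q(x, ω; η)` in the natural parameters. -/
def approxFIM {n m : ℕ} (η : MParam n m) : Matrix (MIndex n m) (MIndex n m) ℝ :=
  fisherInfo ((volume : Measure (Vec n)).prod Measure.count) jointQ η

/-- `E_{q(x | ω = k; η)} [f]`. -/
def compE {n m : ℕ} (η : MParam n m) (k : Fin (m + 1)) (f : Vec n → ℝ) : ℝ :=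
  ∫ x, natGauss (η.comp k) x * f x

/-- `f` has a finite expectation under `q(x | ω = k; η)`. -/
def CompIntegrable {n m : ℕ} (η : MParam n m) (k : Fin (m + 1)) (f : Vec n → ℝ) : Prop :=
  Integrable (fun x => natGauss (η.comp k) x * f x) volume

/-- The Hessian matrix, i.e. the Jacobian of the gradient. -/
def hessian {n : ℕ} (f : Vec n → ℝ) (x : Vec n) : Matrix (Fin n) (Fin n) ℝ :=
  Matrix.of fun i j => (fderiv ℝ (gradient f) x (EuclideanSpace.single j 1)) i

/-! ### The Bayesian model and the flow -/

/-- The joint density `p(x, z) = p(z | x) p(x)`, as a function of `x`. -/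
def jointP {n d : ℕ} (prior : Vec n → ℝ) (lik : Vec d → Vec n → ℝ) (z : Vec d) (x : Vec n) : ℝ :=
  lik z x * prior x

/-- The posterior density `p(x | z) = p(z | x) p(x) / ∫ p(z | x') p(x') dx'`. -/
def posterior {n d : ℕ} (prior : Vec n → ℝ) (lik : Vec d → Vec n → ℝ) (z : Vec d)
    (x : Vec n) : ℝ :=
  jointP prior lik z x / ∫ x', jointP prior lik z x'

/-- The integrand of the Kullback-Leibler divergence. -/
def klIntegrand {n : ℕ} (q p : Vec n → ℝ) (x : Vec n) : ℝ := q x * Real.log (q x / p x)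

/-- The Kullback-Leibler divergence of two densities. -/
def kl {n : ℕ} (q p : Vec n → ℝ) : ℝ := ∫ x, klIntegrand q p x

/-- The objective `η ↦ D_KL (q(·; η) ‖ p(· | z))`. -/
def objective {n m d : ℕ} (prior : Vec n → ℝ) (lik : Vec d → Vec n → ℝ) (z : Vec d)
    (η : MParam n m) : ℝ :=
  kl (mixture η) (posterior prior lik z)

/-- The vector of partial derivatives of a function of the parameters. -/
def partials {ι : Type*} [Fintype ι] [DecidableEq ι] (F : (ι → ℝ) → ℝ) (θ : ι → ℝ) : ι → ℝ :=
  fun a => fderiv ℝ F θ (Pi.single a 1)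

/-- The velocity field `-Ĩ(η)⁻¹ ∇_η D_KL (q(·; η) ‖ p(· | z))` of the approximated Gaussian
mixture Fisher-Rao parameter flow. -/
def flowField {n m d : ℕ} (prior : Vec n → ℝ) (lik : Vec d → Vec n → ℝ) (z : Vec d)
    (η : MParam n m) : MParam n m :=
  -((approxFIM η)⁻¹ *ᵥ partials (objective prior lik z) η)

/-- `V(x; η) = log q(x; η) - log p(x, z)`. -/
def kernelV {n m d : ℕ} (prior : Vec n → ℝ) (lik : Vec d → Vec n → ℝ) (z : Vec d)
    (η : MParam n m) (x : Vec n) : ℝ :=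
  Real.log (mixture η x) - Real.log (jointP prior lik z x)

/-- The component-wise equations at time `t` for a curve of parameters on the time set `I`:
`γ̇ = -E[½ ∇²V Γ⁻¹ γ + ∇V]` and `Γ̇ = -½ E[∇²V]` under the `k`th component, and
`η̇_ω = E_K[V] - E_k[V]`. -/
def ComponentODE {n m d : ℕ} (prior : Vec n → ℝ) (lik : Vec d → Vec n → ℝ) (z : Vec d)
    (c : ℝ → MParam n m) (I : Set ℝ) (t : ℝ) (k : Fin (m + 1)) : Prop :=
  (∀ i, HasDerivWithinAt (fun s => ((c s).comp k).gam i)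
    (-compE (c t) k (fun x =>
      ((1 / 2 : ℝ) • (hessian (kernelV prior lik z (c t)) x *ᵥ
        ((((c t).comp k).Gam)⁻¹ *ᵥ ((c t).comp k).gam))) i
      + gradient (kernelV prior lik z (c t)) x i)) I t) ∧
  (∀ i j, HasDerivWithinAt (fun s => ((c s).comp k).Gam i j)
    (-(1 / 2 : ℝ) * compE (c t) k (fun x => hessian (kernelV prior lik z (c t)) x i j)) I t) ∧
  HasDerivWithinAt (fun s => logOdds (c s).odds k)
    (compE (c t) (Fin.last m) (kernelV prior lik z (c t))
      - compE (c t) k (kernelV prior lik z (c t))) I t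

end GMFlow

end

/-!
For a fixed label `k`, the densities `x ↦ q(x, ω = k; η)` form an exponential family in `η` whose
sufficient statistics are quadratic in `x`. The approximated Fisher information is therefore the
quadratic form `u ↦ ∑ₖ πₖ E_k[⟨sₖ, u⟩²]` of the scores `sₖ`, and each `sₖ` is a Gaussian score, of
mean zero under the `k`th component, plus the score of the weights, which does not depend on `x`.
This yields block diagonality, and definiteness because a quadratic polynomial vanishing
identically is zero.

The divergence may be differentiated under the integral sign because the parameters form an open
set: integrability against a slightly wider Gaussian leaves room for polynomial factors. Since the
mean of the score of `q(·; η)` vanishes, the derivative in the direction `v` is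
`∑ₖ πₖ E_k[⟨sₖ, v⟩ V]`. By Stein's identity, a function whose mean, mean gradient and mean Hessian
vanish under a Gaussian is orthogonal to all quadratic polynomials. Hence the quadratic polynomial
which agrees with `V` in these three means is, on each component, the projection of `V` onto the
polynomials spanned by the scores and the constants, and its coefficients are the natural gradient.
-/

noncomputable section

namespace GMFlow

open Filter Asymptotics
open scoped Topology

/-! ### Growth and Gaussian integrability -/

section Growth

variable {E F : Type*} [NormedAddCommGroup E] [NormedAddCommGroup F]

/-- A continuous function that grows more slowly than every `x ↦ exp (δ * ‖x‖ ^ 2)`, `δ > 0`.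
Multiplication by such functions preserves `ExpIntegrable`. -/
structure ModerateGrowth (f : E → F) : Prop where
  continuous : Continuous f
  isBigO (δ : ℝ) : 0 < δ → f =O[⊤] fun x => Real.exp (δ * ‖x‖ ^ 2)

theorem isBigO_const_one_add_norm_sq (c : F) : (fun _ : E => c) =O[⊤] fun x => 1 + ‖x‖ ^ 2 :=
  isBigO_top.2 ⟨‖c‖, fun x => le_mul_of_one_le_right (norm_nonneg c) <|
    (le_add_of_nonneg_right (by positivity)).trans (le_abs_self _)⟩

theorem isBigO_one_add_norm_sq_exp {δ : ℝ} (hδ : 0 < δ) :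
    (fun x : E => 1 + ‖x‖ ^ 2) =O[⊤] fun x => Real.exp (δ * ‖x‖ ^ 2) := by
  refine isBigO_top.2 ⟨1 + δ⁻¹, fun x => ?_⟩
  have hexp := Real.add_one_le_exp (δ * ‖x‖ ^ 2)
  rw [Real.norm_of_nonneg (by positivity), Real.norm_of_nonneg (by positivity)]
  calc 1 + ‖x‖ ^ 2 ≤ (1 + δ⁻¹) * (δ * ‖x‖ ^ 2 + 1) := by
        have : (1 + δ⁻¹) * (δ * ‖x‖ ^ 2 + 1) = 1 + ‖x‖ ^ 2 + δ * ‖x‖ ^ 2 + δ⁻¹ := by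
          field_simp; ring
        rw [this, add_assoc]
        exact le_add_of_nonneg_right (by positivity)
    _ ≤ _ := by gcongr

namespace ModerateGrowth

theorem of_isBigO_one_add_norm_sq {f : E → F} (hf : Continuous f)
    (h : f =O[⊤] fun x => 1 + ‖x‖ ^ 2) : ModerateGrowth f :=
  ⟨hf, fun _ hδ => h.trans (isBigO_one_add_norm_sq_exp hδ)⟩

theorem const (c : F) : ModerateGrowth fun _ : E => c :=
  of_isBigO_one_add_norm_sq continuous_const (isBigO_const_one_add_norm_sq c)

theorem one_add_norm_sq : ModerateGrowth fun x : E => 1 + ‖x‖ ^ 2 :=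
  of_isBigO_one_add_norm_sq (by fun_prop) (isBigO_refl _ _)

theorem norm {f : E → F} (hf : ModerateGrowth f) : ModerateGrowth fun x => ‖f x‖ :=
  ⟨hf.continuous.norm, fun δ hδ => (hf.isBigO δ hδ).norm_left⟩

theorem add {f g : E → F} (hf : ModerateGrowth f) (hg : ModerateGrowth g) :
    ModerateGrowth fun x => f x + g x :=
  ⟨hf.continuous.add hg.continuous, fun δ hδ => (hf.isBigO δ hδ).add (hg.isBigO δ hδ)⟩

theorem sub {f g : E → F} (hf : ModerateGrowth f) (hg : ModerateGrowth g) :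
    ModerateGrowth fun x => f x - g x :=
  ⟨hf.continuous.sub hg.continuous, fun δ hδ => (hf.isBigO δ hδ).sub (hg.isBigO δ hδ)⟩

theorem sum {ι : Type*} (s : Finset ι) {f : ι → E → F} (hf : ∀ i ∈ s, ModerateGrowth (f i)) :
    ModerateGrowth fun x => ∑ i ∈ s, f i x :=
  ⟨continuous_finsetSum s fun i hi => (hf i hi).continuous,
    fun δ hδ => IsBigO.fun_sum fun i hi => (hf i hi).isBigO δ hδ⟩

theorem mul {f g : E → ℝ} (hf : ModerateGrowth f) (hg : ModerateGrowth g) :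
    ModerateGrowth fun x => f x * g x := by
  refine ⟨hf.continuous.mul hg.continuous, fun δ hδ => ?_⟩
  have h := (hf.isBigO (δ / 2) (half_pos hδ)).mul (hg.isBigO (δ / 2) (half_pos hδ))
  exact h.congr_right fun x => by rw [← Real.exp_add]; ring_nf

theorem clm_apply [NormedSpace ℝ F] {f : E → F →L[ℝ] ℝ} (hf : ModerateGrowth f) (v : F) :
    ModerateGrowth fun x => f x v :=
  ⟨hf.continuous.clm_apply continuous_const, fun δ hδ =>
    ((ContinuousLinearMap.apply ℝ ℝ v).isBigO_comp f ⊤).trans (hf.isBigO δ hδ)⟩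

end ModerateGrowth

end Growth

section ExpIntegrable

variable {E : Type*} [NormedAddCommGroup E] [MeasureSpace E] {u f g : E → ℝ}

/-- `f` is integrable against the weight `exp u`, with some Gaussian room to spare. The room is
what makes integrability stable under perturbation of `u` and under multiplication by functions
of moderate growth. -/
def ExpIntegrable (u f : E → ℝ) : Prop :=
  ∃ ε > 0, Integrable fun x => Real.exp (u x + ε * ‖x‖ ^ 2) * f x

theorem ExpIntegrable.norm (hf : ExpIntegrable u f) : ExpIntegrable u fun x => ‖f x‖ := by
  obtain ⟨ε, hε, hf⟩ := hf
  exact ⟨ε, hε, hf.norm.congr (.of_forall fun x => by simp)⟩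

variable [BorelSpace E]

theorem integrable_exp_add_mul_of_le {ε δ : ℝ} (hδ : δ ≤ ε)
    (h : Integrable fun x => Real.exp (u x + ε * ‖x‖ ^ 2) * f x) :
    Integrable fun x => Real.exp (u x + δ * ‖x‖ ^ 2) * f x := by
  have hbdd (x : E) : ‖Real.exp (-((ε - δ) * ‖x‖ ^ 2))‖ ≤ 1 := by
    rw [Real.norm_of_nonneg (Real.exp_pos _).le, Real.exp_le_one_iff, neg_nonpos]
    exact mul_nonneg (sub_nonneg.2 hδ) (sq_nonneg _)
  have hmul := h.bdd_mul (by fun_prop) (.of_forall hbdd)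
  refine hmul.congr (.of_forall fun x => ?_)
  simp only [← mul_assoc, ← Real.exp_add]
  ring_nf

namespace ExpIntegrable

theorem integrable (hf : ExpIntegrable u f) : Integrable fun x => Real.exp (u x) * f x := by
  obtain ⟨ε, hε, hf⟩ := hf
  simpa using integrable_exp_add_mul_of_le hε.le hf

theorem add (hf : ExpIntegrable u f) (hg : ExpIntegrable u g) :
    ExpIntegrable u fun x => f x + g x := by
  obtain ⟨ε, hε, hf⟩ := hf
  obtain ⟨δ, hδ, hg⟩ := hg
  refine ⟨min ε δ, lt_min hε hδ, ?_⟩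
  simpa only [mul_add] using (integrable_exp_add_mul_of_le (min_le_left ε δ) hf).fun_add
    (integrable_exp_add_mul_of_le (min_le_right ε δ) hg)

theorem moderateGrowth_mul (hf : ModerateGrowth f) (hg : ExpIntegrable u g) :
    ExpIntegrable u fun x => f x * g x := by
  obtain ⟨ε, hε, hg⟩ := hg
  obtain ⟨C, hC⟩ := isBigO_top.1 (hf.isBigO (ε / 2) (half_pos hε))
  have hbdd (x : E) : ‖Real.exp (-(ε / 2 * ‖x‖ ^ 2)) * f x‖ ≤ C := by
    rw [norm_mul, Real.norm_of_nonneg (Real.exp_pos _).le, Real.exp_neg,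
      inv_mul_le_iff₀ (Real.exp_pos _), mul_comm]
    simpa only [Real.norm_of_nonneg (Real.exp_pos _).le] using hC x
  have hcont := hf.continuous
  refine ⟨ε / 2, half_pos hε, (hg.bdd_mul (by fun_prop) (.of_forall hbdd)).congr
    (.of_forall fun x => ?_)⟩
  have hexp : Real.exp (u x + ε / 2 * ‖x‖ ^ 2) =
      Real.exp (-(ε / 2 * ‖x‖ ^ 2)) * Real.exp (u x + ε * ‖x‖ ^ 2) := by
    rw [← Real.exp_add]; ring_nf
  simp only [hexp]
  ring

theorem const_mul (c : ℝ) (hf : ExpIntegrable u f) : ExpIntegrable u fun x => c * f x :=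
  hf.moderateGrowth_mul (.const c)

theorem neg (hf : ExpIntegrable u f) : ExpIntegrable u fun x => -f x := by
  simpa using hf.const_mul (-1)

theorem sub (hf : ExpIntegrable u f) (hg : ExpIntegrable u g) :
    ExpIntegrable u fun x => f x - g x := by
  simpa only [sub_eq_add_neg] using hf.add hg.neg

end ExpIntegrable

theorem ModerateGrowth.expIntegrable (hf : ModerateGrowth f)
    (h : ExpIntegrable u fun _ => 1) : ExpIntegrable u f := by
  simpa using h.moderateGrowth_mul hf

end ExpIntegrable

/-! ### Partial derivatives on Euclidean space -/

section PartialDeriv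

variable {n : ℕ} {f g : Vec n → ℝ} {x : Vec n}

/-- The partial derivative in the `i`th coordinate, `∂ᵢ f`. -/
def partialDeriv (i : Fin n) (f : Vec n → ℝ) (x : Vec n) : ℝ :=
  fderiv ℝ f x (EuclideanSpace.single i 1)

theorem gradient_apply (f : Vec n → ℝ) (x : Vec n) (i : Fin n) :
    gradient f x i = partialDeriv i f x := by
  rw [partialDeriv, ← toDual_gradient (𝕜 := ℝ) (f := f) (x := x),
    InnerProductSpace.toDual_apply_apply, EuclideanSpace.inner_single_right]
  simp

theorem contDiff_partialDeriv (hf : ContDiff ℝ 2 f) (i : Fin n) :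
    ContDiff ℝ 1 (partialDeriv i f) :=
  (hf.fderiv_right (by norm_num)).clm_apply contDiff_const

theorem hessian_apply (hf : ContDiff ℝ 2 f) (x : Vec n) (i j : Fin n) :
    hessian f x i j = partialDeriv j (partialDeriv i f) x := by
  have hgrad : ContDiff ℝ 1 (gradient f) :=
    ((InnerProductSpace.toDual ℝ (Vec n)).symm.contDiff.restrict_scalars ℝ).comp
      (hf.fderiv_right (by norm_num))
  have hcoord : partialDeriv i f = EuclideanSpace.proj (𝕜 := ℝ) i ∘ gradient f := by
    ext y; simp [gradient_apply]
  have hfderiv := (EuclideanSpace.proj (𝕜 := ℝ) i : Vec n →L[ℝ] ℝ).hasFDerivAt.comp x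
    (hgrad.differentiable one_ne_zero x).hasFDerivAt
  rw [hessian, Matrix.of_apply, partialDeriv, hcoord, hfderiv.fderiv]
  simp

theorem partialDeriv_comm (hf : ContDiff ℝ 2 f) (x : Vec n) (i j : Fin n) :
    partialDeriv j (partialDeriv i f) x = partialDeriv i (partialDeriv j f) x := by
  have hdiff : DifferentiableAt ℝ (fderiv ℝ f) x :=
    (hf.fderiv_right (m := 1) (by norm_num)).differentiable one_ne_zero x
  have hsnd (k l : Fin n) : partialDeriv k (partialDeriv l f) x = fderiv ℝ (fderiv ℝ f) x
      (EuclideanSpace.single k 1) (EuclideanSpace.single l 1) := by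
    unfold partialDeriv
    rw [fderiv_clm_apply hdiff (differentiableAt_const _)]
    simp
  rw [hsnd, hsnd]
  exact hf.contDiffAt.isSymmSndFDerivAt (by simp) _ _

theorem partialDeriv_sub (hf : DifferentiableAt ℝ f x) (hg : DifferentiableAt ℝ g x) (i : Fin n) :
    partialDeriv i (fun y => f y - g y) x = partialDeriv i f x - partialDeriv i g x := by
  simp [partialDeriv, fderiv_fun_sub hf hg]

theorem partialDeriv_mul (hf : DifferentiableAt ℝ f x) (hg : DifferentiableAt ℝ g x) (i : Fin n) :
    partialDeriv i (fun y => f y * g y) x =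
      f x * partialDeriv i g x + partialDeriv i f x * g x := by
  simp [partialDeriv, fderiv_fun_mul hf hg, mul_comm (g x)]

theorem partialDeriv_sum {ι : Type*} {s : Finset ι} {F : ι → Vec n → ℝ}
    (hF : ∀ k ∈ s, DifferentiableAt ℝ (F k) x) (i : Fin n) :
    partialDeriv i (fun y => ∑ k ∈ s, F k y) x = ∑ k ∈ s, partialDeriv i (F k) x := by
  simp [partialDeriv, fderiv_fun_sum hF]

theorem partialDeriv_exp (hf : DifferentiableAt ℝ f x) (i : Fin n) :
    partialDeriv i (fun y => Real.exp (f y)) x = Real.exp (f x) * partialDeriv i f x := by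
  simp [partialDeriv, hf.hasFDerivAt.exp.fderiv]

theorem partialDeriv_const (c : ℝ) (i : Fin n) (x : Vec n) :
    partialDeriv i (fun _ => c) x = 0 := by
  simp [partialDeriv]

theorem hasFDerivAt_coord (j : Fin n) (x : Vec n) :
    HasFDerivAt (fun y : Vec n => y j) (EuclideanSpace.proj (𝕜 := ℝ) j) x :=
  (EuclideanSpace.proj (𝕜 := ℝ) j : Vec n →L[ℝ] ℝ).hasFDerivAt

theorem partialDeriv_coord (i j : Fin n) (x : Vec n) :
    partialDeriv i (fun y => y j) x = if j = i then 1 else 0 := by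
  simp [partialDeriv, (hasFDerivAt_coord j x).fderiv]

end PartialDeriv

/-! ### The log-sum-exp function -/

section LogSumExp

variable {K : Type*} [Fintype K]

/-- The log-sum-exp function `a ↦ log ∑ₖ exp aₖ`: the logarithm of a mixture in terms of the
logarithms of its terms, and the log-partition function of a categorical distribution. -/
def logSumExp (a : K → ℝ) : ℝ := Real.log (∑ k, Real.exp (a k))

/-- The gradient of `logSumExp`: the probability weights proportional to `exp aₖ`. -/
def softmax (a : K → ℝ) (k : K) : ℝ := Real.exp (a k - logSumExp a)

theorem softmax_pos (a : K → ℝ) (k : K) : 0 < softmax a k := Real.exp_pos _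

variable [Nonempty K]

theorem exp_logSumExp (a : K → ℝ) : Real.exp (logSumExp a) = ∑ k, Real.exp (a k) :=
  Real.exp_log (Finset.sum_pos (fun _ _ => Real.exp_pos _) Finset.univ_nonempty)

theorem softmax_eq_div (a : K → ℝ) (k : K) :
    softmax a k = Real.exp (a k) / ∑ j, Real.exp (a j) := by
  rw [softmax, Real.exp_sub, exp_logSumExp]

theorem sum_softmax (a : K → ℝ) : ∑ k, softmax a k = 1 := by
  simp only [softmax_eq_div, ← Finset.sum_div]
  exact div_self (Finset.sum_pos (fun _ _ => Real.exp_pos _) Finset.univ_nonempty).ne'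

theorem softmax_le_one (a : K → ℝ) (k : K) : softmax a k ≤ 1 :=
  (Finset.single_le_sum (fun j _ => (softmax_pos a j).le) (Finset.mem_univ k)).trans_eq
    (sum_softmax a)

theorem contDiff_logSumExp {r : WithTop ℕ∞} : ContDiff ℝ r (logSumExp : (K → ℝ) → ℝ) := by
  unfold logSumExp
  exact ContDiff.log (by fun_prop) fun a =>
    (Finset.sum_pos (fun _ _ => Real.exp_pos _) Finset.univ_nonempty).ne'

theorem hasFDerivAt_logSumExp (a : K → ℝ) :
    HasFDerivAt logSumExp
      (∑ k, softmax a k • (ContinuousLinearMap.proj k : (K → ℝ) →L[ℝ] ℝ)) a := by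
  have hsum : HasFDerivAt (fun a : K → ℝ => ∑ k, Real.exp (a k))
      (∑ k, Real.exp (a k) • (ContinuousLinearMap.proj k : (K → ℝ) →L[ℝ] ℝ)) a :=
    HasFDerivAt.fun_sum fun k _ => (hasFDerivAt_apply k a).exp
  refine (hsum.log (Finset.sum_pos (fun _ _ => Real.exp_pos _)
    Finset.univ_nonempty).ne').congr_fderiv ?_
  simp only [softmax_eq_div, Finset.smul_sum, smul_smul, div_eq_inv_mul]

theorem abs_logSumExp_le {a : K → ℝ} {B : ℝ} (ha : ∀ k, |a k| ≤ B) :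
    |logSumExp a| ≤ B + Real.log (Fintype.card K) := by
  have hcard : (1 : ℝ) ≤ Fintype.card K := mod_cast Fintype.card_pos
  have hlower : -B ≤ logSumExp a := by
    obtain ⟨k⟩ := ‹Nonempty K›
    have := Real.log_le_log (Real.exp_pos _) (Finset.single_le_sum (f := fun k => Real.exp (a k))
      (fun j _ => (Real.exp_pos _).le) (Finset.mem_univ k))
    rw [Real.log_exp] at this
    exact (neg_le_of_abs_le (ha k)).trans this
  have hupper : logSumExp a ≤ B + Real.log (Fintype.card K) := by
    rw [← Real.log_exp (B + _), Real.exp_add, Real.exp_log (by positivity)]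
    refine Real.log_le_log (Finset.sum_pos (fun _ _ => Real.exp_pos _) Finset.univ_nonempty) ?_
    calc ∑ k, Real.exp (a k) ≤ ∑ _k : K, Real.exp B :=
          Finset.sum_le_sum fun k _ => Real.exp_le_exp.2 (le_of_abs_le (ha k))
      _ = Real.exp B * Fintype.card K := by simp [mul_comm]
  exact abs_le.2 ⟨by linarith [Real.log_nonneg hcard], hupper⟩

theorem norm_sum_softmax_smul_le {F : Type*} [NormedAddCommGroup F] [NormedSpace ℝ F]
    {a : K → ℝ} {v : K → F} {B : ℝ} (hv : ∀ k, ‖v k‖ ≤ B) :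
    ‖∑ k, softmax a k • v k‖ ≤ B := by
  refine (norm_sum_le _ _).trans ?_
  calc ∑ k, ‖softmax a k • v k‖ ≤ ∑ k, softmax a k * B := by
        gcongr with k
        rw [norm_smul, Real.norm_of_nonneg (softmax_pos a k).le]
        exact mul_le_mul_of_nonneg_left (hv k) (softmax_pos a k).le
    _ = B := by rw [← Finset.sum_mul, sum_softmax, one_mul]

end LogSumExp

section LogSumExpGrowth

variable {n : ℕ} {K : Type*} [Fintype K] {u f g : Vec n → ℝ} {a : K → Vec n → ℝ}

/-- A `C²` function which, together with its first and second partial derivatives, has moderate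
growth. -/
structure ModerateGrowthC2 (f : Vec n → ℝ) : Prop where
  contDiff : ContDiff ℝ 2 f
  base : ModerateGrowth f
  deriv₁ (i : Fin n) : ModerateGrowth (partialDeriv i f)
  deriv₂ (i j : Fin n) : ModerateGrowth (partialDeriv j (partialDeriv i f))

/-- A `C²` function which, together with its first and second partial derivatives, is integrable
against the weight `exp u` with room to spare. -/
structure ExpIntegrableC2 (u f : Vec n → ℝ) : Prop where
  contDiff : ContDiff ℝ 2 f
  base : ExpIntegrable u f
  deriv₁ (i : Fin n) : ExpIntegrable u (partialDeriv i f)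
  deriv₂ (i j : Fin n) : ExpIntegrable u (partialDeriv j (partialDeriv i f))

theorem ModerateGrowthC2.expIntegrableC2 (hf : ModerateGrowthC2 f)
    (hu : ExpIntegrable u fun _ => 1) : ExpIntegrableC2 u f :=
  ⟨hf.contDiff, hf.base.expIntegrable hu, fun i => (hf.deriv₁ i).expIntegrable hu,
    fun i j => (hf.deriv₂ i j).expIntegrable hu⟩

theorem ExpIntegrableC2.sub (hf : ExpIntegrableC2 u f) (hg : ExpIntegrableC2 u g) :
    ExpIntegrableC2 u fun x => f x - g x := by
  have hfst (i : Fin n) : partialDeriv i (fun x => f x - g x) =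
      fun x => partialDeriv i f x - partialDeriv i g x :=
    funext fun x => partialDeriv_sub (hf.contDiff.differentiable two_ne_zero x)
      (hg.contDiff.differentiable two_ne_zero x) i
  have hsnd (i j : Fin n) : partialDeriv j (partialDeriv i fun x => f x - g x) =
      fun x => partialDeriv j (partialDeriv i f) x -
        partialDeriv j (partialDeriv i g) x := by
    rw [hfst]
    exact funext fun x => partialDeriv_sub
      ((contDiff_partialDeriv hf.contDiff i).differentiable one_ne_zero x)
      ((contDiff_partialDeriv hg.contDiff i).differentiable one_ne_zero x) j
  refine ⟨hf.contDiff.sub hg.contDiff, hf.base.sub hg.base, fun i => ?_, fun i j => ?_⟩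
  · rw [hfst]
    exact (hf.deriv₁ i).sub (hg.deriv₁ i)
  · rw [hsnd]
    exact (hf.deriv₂ i j).sub (hg.deriv₂ i j)

variable [Nonempty K]

theorem contDiff_logSumExp_comp {r : WithTop ℕ∞} (ha : ∀ k, ContDiff ℝ r (a k)) :
    ContDiff ℝ r fun x => logSumExp fun k => a k x :=
  contDiff_logSumExp.comp (contDiff_pi.2 ha)

theorem contDiff_softmax_comp {r : WithTop ℕ∞} (ha : ∀ k, ContDiff ℝ r (a k)) (k : K) :
    ContDiff ℝ r fun x => softmax (fun k => a k x) k :=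
  ((ha k).sub (contDiff_logSumExp_comp ha)).exp

theorem partialDeriv_logSumExp {x : Vec n} (ha : ∀ k, DifferentiableAt ℝ (a k) x) (i : Fin n) :
    partialDeriv i (fun x => logSumExp fun k => a k x) x =
      ∑ k, softmax (fun k => a k x) k * partialDeriv i (a k) x := by
  have hderiv := (hasFDerivAt_logSumExp fun k => a k x).comp x
    (hasFDerivAt_pi.2 fun k => (ha k).hasFDerivAt)
  simp only [partialDeriv]
  rw [show (fun x => logSumExp fun k => a k x) = logSumExp ∘ fun x k => a k x from rfl,
    hderiv.fderiv]
  simp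

theorem partialDeriv_softmax {x : Vec n} (ha : ∀ k, DifferentiableAt ℝ (a k) x) (i : Fin n)
    (k : K) : partialDeriv i (fun x => softmax (fun k => a k x) k) x =
      softmax (fun k => a k x) k *
        (partialDeriv i (a k) x - ∑ l, softmax (fun k => a k x) l * partialDeriv i (a l) x) := by
  have hlse : DifferentiableAt ℝ (fun x => logSumExp fun k => a k x) x :=
    (contDiff_logSumExp.differentiable one_ne_zero _).comp x (differentiableAt_pi.2 ha)
  unfold softmax
  rw [partialDeriv_exp ((ha k).fun_sub hlse), partialDeriv_sub (ha k) hlse,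
    partialDeriv_logSumExp ha]
  rfl

theorem moderateGrowth_softmax (ha : ∀ k, Continuous (a k)) (k : K) :
    ModerateGrowth fun x => softmax (fun k => a k x) k := by
  refine .of_isBigO_one_add_norm_sq ?_ ?_
  · exact ((ha k).sub ((contDiff_logSumExp (r := 0)).continuous.comp (continuous_pi ha))).rexp
  · refine (isBigO_of_le _ fun x => ?_).trans (isBigO_const_one_add_norm_sq (1 : ℝ))
    rw [Real.norm_of_nonneg (softmax_pos _ k).le, norm_one]
    exact softmax_le_one _ k

theorem moderateGrowth_logSumExp (ha : ∀ k, ModerateGrowth (a k)) :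
    ModerateGrowth fun x => logSumExp fun k => a k x := by
  have hcont : Continuous fun x => logSumExp fun k => a k x :=
    (contDiff_logSumExp (r := 0)).continuous.comp (continuous_pi fun k => (ha k).continuous)
  have hbound : ModerateGrowth fun x => ∑ k, ‖a k x‖ + Real.log (Fintype.card K) :=
    (ModerateGrowth.sum _ fun k _ => (ha k).norm).add (.const _)
  refine ⟨hcont, fun δ hδ => (isBigO_of_le _ fun x => ?_).trans (hbound.isBigO δ hδ)⟩
  refine (abs_logSumExp_le fun k => ?_).trans (le_abs_self _)
  exact Finset.single_le_sum (f := fun k => ‖a k x‖) (fun _ _ => norm_nonneg _) (Finset.mem_univ k)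

theorem moderateGrowthC2_logSumExp (ha : ∀ k, ModerateGrowthC2 (a k)) :
    ModerateGrowthC2 fun x => logSumExp fun k => a k x := by
  have hdiff (k : K) : Differentiable ℝ (a k) := (ha k).contDiff.differentiable two_ne_zero
  have hdiff' (k : K) (i : Fin n) : Differentiable ℝ (partialDeriv i (a k)) :=
    (contDiff_partialDeriv (ha k).contDiff i).differentiable one_ne_zero
  have hsoft (k : K) := moderateGrowth_softmax (fun k => (hdiff k).continuous) k
  have hsoftdiff (k : K) : Differentiable ℝ fun x => softmax (fun k => a k x) k :=
    (contDiff_softmax_comp (fun k => (ha k).contDiff) k).differentiable two_ne_zero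
  have hfst (i : Fin n) : partialDeriv i (fun x => logSumExp fun k => a k x) =
      fun x => ∑ k, softmax (fun k => a k x) k * partialDeriv i (a k) x :=
    funext fun x => partialDeriv_logSumExp (fun k => hdiff k x) i
  refine ⟨contDiff_logSumExp_comp fun k => (ha k).contDiff,
    moderateGrowth_logSumExp fun k => (ha k).base, fun i => ?_, fun i j => ?_⟩
  · rw [hfst]
    exact .sum _ fun k _ => (hsoft k).mul ((ha k).deriv₁ i)
  · have hsnd : partialDeriv j (partialDeriv i fun x =>
        logSumExp fun k => a k x) = fun x => ∑ k,
          (softmax (fun k => a k x) k * partialDeriv j (partialDeriv i (a k)) x +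
            softmax (fun k => a k x) k * (partialDeriv j (a k) x -
              ∑ l, softmax (fun k => a k x) l * partialDeriv j (a l) x) *
                partialDeriv i (a k) x) := by
      rw [hfst]
      funext x
      rw [partialDeriv_sum fun k _ => (hsoftdiff k x).fun_mul (hdiff' k i x)]
      refine Finset.sum_congr rfl fun k _ => ?_
      rw [partialDeriv_mul (hsoftdiff k x) (hdiff' k i x),
        partialDeriv_softmax fun k => hdiff k x]
    rw [hsnd]
    exact .sum _ fun k _ => ((hsoft k).mul ((ha k).deriv₂ i j)).add
      (((hsoft k).mul (((ha k).deriv₁ j).sub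
        (.sum _ fun l _ => (hsoft l).mul ((ha l).deriv₁ j)))).mul ((ha k).deriv₁ i))

end LogSumExpGrowth

/-! ### Positive definite matrices and Gaussian integrals -/

section PosDef

variable {ι : Type*} [Fintype ι]

theorem dotProduct_mulVec_eq_sum (M : Matrix ι ι ℝ) (u v : ι → ℝ) :
    u ⬝ᵥ (M *ᵥ v) = ∑ i, ∑ j, u i * v j * M i j := by
  simp only [dotProduct, Matrix.mulVec, Finset.mul_sum]
  exact Finset.sum_congr rfl fun i _ => Finset.sum_congr rfl fun j _ => by ring

theorem posDef_of_forall_mem_sphere {M : Matrix ι ι ℝ} (hM : M.IsHermitian)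
    (h : ∀ v ∈ Metric.sphere (0 : ι → ℝ) 1, 0 < v ⬝ᵥ (M *ᵥ v)) : M.PosDef := by
  refine Matrix.PosDef.of_dotProduct_mulVec_pos hM fun v hv => ?_
  have hpos : 0 < ‖v‖ := norm_pos_iff.2 hv
  have hsphere := h (‖v‖⁻¹ • v) (by simp [norm_smul, hpos.ne'])
  rw [Matrix.mulVec_smul, smul_dotProduct, dotProduct_smul, smul_eq_mul, smul_eq_mul] at hsphere
  rw [star_trivial]
  exact pos_of_mul_pos_right (pos_of_mul_pos_right hsphere (by positivity)) (by positivity)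

theorem isOpen_setOf_posDef {ι X : Type*} [Finite ι] [TopologicalSpace X] {M : X → Matrix ι ι ℝ}
    (hM : Continuous M) (hsymm : ∀ x, (M x).IsHermitian) : IsOpen {x | (M x).PosDef} := by
  have := Fintype.ofFinite ι
  refine isOpen_iff_mem_nhds.2 fun x₀ hx₀ => ?_
  have hcont : Continuous fun p : X × (ι → ℝ) => p.2 ⬝ᵥ (M p.1 *ᵥ p.2) := by fun_prop
  have hsphere := (isCompact_sphere (0 : ι → ℝ) 1).eventually_forall_of_forall_eventually
    (x₀ := x₀) (P := fun x v => 0 < v ⬝ᵥ (M x *ᵥ v)) fun v hv =>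
      hcont.continuousAt.eventually (lt_mem_nhds ?_)
  · exact hsphere.mono fun x hx => posDef_of_forall_mem_sphere (hsymm x) hx
  · have hv0 : v ≠ 0 := ne_zero_of_mem_unit_sphere ⟨v, hv⟩
    simpa using hx₀.dotProduct_mulVec_pos hv0

theorem integral_exp_neg_half_norm_sq :
    ∫ x : EuclideanSpace ℝ ι, Real.exp (-(1 / 2) * ‖x‖ ^ 2) =
      √((2 * Real.pi) ^ Fintype.card ι) := by
  rw [GaussianFourier.integral_rexp_neg_mul_sq_norm (by norm_num), Real.sqrt_eq_rpow,
    ← Real.rpow_natCast, ← Real.rpow_mul (by positivity), finrank_euclideanSpace]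
  congr 1 <;> ring

variable [DecidableEq ι]

open scoped MatrixOrder in
theorem exists_transpose_mul_self {M : Matrix ι ι ℝ} (hM : M.PosDef) :
    ∃ B : Matrix ι ι ℝ, M = Bᵀ * B ∧ B.det ≠ 0 := by
  obtain ⟨B, hB⟩ := CStarAlgebra.nonneg_iff_eq_star_mul_self.1
    (Matrix.nonneg_iff_posSemidef.2 hM.posSemidef)
  refine ⟨B, by simpa [Matrix.star_eq_conjTranspose] using hB, fun hdet => hM.det_pos.ne' ?_⟩
  rw [hB, Matrix.det_mul, hdet, mul_zero]

theorem norm_sq_toLpLin (B : Matrix ι ι ℝ) (x : EuclideanSpace ℝ ι) :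
    ‖Matrix.toLpLin 2 2 B x‖ ^ 2 = x.ofLp ⬝ᵥ ((Bᵀ * B) *ᵥ x.ofLp) := by
  rw [EuclideanSpace.norm_sq_eq, ← Matrix.mulVec_mulVec, Matrix.dotProduct_mulVec,
    Matrix.vecMul_transpose]
  simp [Matrix.toLpLin_apply, dotProduct, pow_two]

theorem integral_comp_linearMap {E : Type*} [NormedAddCommGroup E] [NormedSpace ℝ E]
    [FiniteDimensional ℝ E] [MeasurableSpace E] [BorelSpace E] (ν : Measure E) [ν.IsAddHaarMeasure]
    {L : E →ₗ[ℝ] E} (hL : LinearMap.det L ≠ 0) {f : E → ℝ} (hf : Continuous f) :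
    ∫ x, f (L x) ∂ν = |LinearMap.det L|⁻¹ * ∫ x, f x ∂ν := by
  rw [← integral_map (φ := L) L.continuous_of_finiteDimensional.measurable.aemeasurable
    hf.aestronglyMeasurable, Measure.map_linearMap_addHaar_eq_smul_addHaar ν hL,
    integral_smul_measure, ENNReal.toReal_ofReal (abs_nonneg _), abs_inv, smul_eq_mul]

theorem integral_exp_neg_half_quadratic {M : Matrix ι ι ℝ} (hM : M.PosDef) (μ : ι → ℝ) :
    ∫ x : EuclideanSpace ℝ ι, Real.exp (-(1 / 2) *
        ((fun i => x i - μ i) ⬝ᵥ (M *ᵥ fun i => x i - μ i))) =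
      √((2 * Real.pi) ^ Fintype.card ι / M.det) := by
  obtain ⟨B, rfl, hB⟩ := exists_transpose_mul_self hM
  let L : EuclideanSpace ℝ ι →ₗ[ℝ] EuclideanSpace ℝ ι := Matrix.toLpLin 2 2 B
  have hdet : LinearMap.det L = B.det := by
    simp only [L, Matrix.toLpLin_eq_toLin, LinearMap.det_toLin]
  calc _ = ∫ x : EuclideanSpace ℝ ι, Real.exp (-(1 / 2) * ‖L (x - WithLp.toLp 2 μ)‖ ^ 2) := by
        simp only [L, norm_sq_toLpLin]; rfl
    _ = ∫ x : EuclideanSpace ℝ ι, Real.exp (-(1 / 2) * ‖L x‖ ^ 2) :=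
        integral_sub_right_eq_self (fun x => Real.exp (-(1 / 2) * ‖L x‖ ^ 2)) _
    _ = |B.det|⁻¹ * √((2 * Real.pi) ^ Fintype.card ι) := by
        rw [integral_comp_linearMap volume (hdet ▸ hB)
          (f := fun x => Real.exp (-(1 / 2) * ‖x‖ ^ 2)) (by fun_prop), hdet,
          integral_exp_neg_half_norm_sq]
    _ = _ := by
        rw [Matrix.det_mul, Matrix.det_transpose, Real.sqrt_div (by positivity),
          Real.sqrt_mul_self_eq_abs, inv_mul_eq_div]

variable {E : Type*} [NormedAddCommGroup E] [NormedSpace ℝ E] {r : WithTop ℕ∞}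
  {M : E → Matrix ι ι ℝ} {e : E}

theorem contDiffAt_det (hM : ∀ i j, ContDiffAt ℝ r (fun e => M e i j) e) :
    ContDiffAt ℝ r (fun e => (M e).det) e := by
  simp only [Matrix.det_apply]
  exact ContDiffAt.sum fun σ _ => (contDiffAt_prod fun i _ => hM _ _).const_smul _

theorem contDiffAt_inv_apply (hM : ∀ i j, ContDiffAt ℝ r (fun e => M e i j) e)
    (hdet : (M e).det ≠ 0) (i j : ι) : ContDiffAt ℝ r (fun e => (M e)⁻¹ i j) e := by
  have hadj : ContDiffAt ℝ r (fun e => (M e).adjugate i j) e := by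
    simp only [Matrix.adjugate_apply]
    refine contDiffAt_det fun k l => ?_
    by_cases hk : k = j
    · subst hk
      simpa only [Matrix.updateRow_self] using contDiffAt_const
    · simpa only [Matrix.updateRow_ne hk] using hM k l
  simp only [Matrix.inv_def, Ring.inverse_eq_inv', Matrix.smul_apply, smul_eq_mul]
  exact ((contDiffAt_det hM).inv hdet).mul hadj

end PosDef

/-! ### The Gaussian in natural parameters -/

section Gaussian

variable {n : ℕ}

/-- The sufficient statistics of the Gaussian: the linear functional `(γ, Γ) ↦ γᵀ x + xᵀ Γ x`. -/
def suff (x : Vec n) : GParam n →L[ℝ] ℝ :=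
  ∑ i, x i • ContinuousLinearMap.proj (Sum.inl i) +
    ∑ i, ∑ j, (x i * x j) • ContinuousLinearMap.proj (Sum.inr ⟨(min i j, max i j), min_le_max⟩)

theorem suff_apply (x : Vec n) (θ : GParam n) :
    suff x θ = ∑ i, x i * θ.gam i + ∑ i, ∑ j, x i * x j * θ.Gam i j := by
  simp [suff, GParam.gam, GParam.Gam]

theorem Gam_symm (θ : GParam n) (i j : Fin n) : θ.Gam i j = θ.Gam j i := by
  simp [GParam.Gam, min_comm, max_comm]

theorem continuous_suff : Continuous (suff : Vec n → GParam n →L[ℝ] ℝ) := by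
  unfold suff; fun_prop

theorem isBigO_coord (i : Fin n) : (fun x : Vec n => x i) =O[⊤] fun x => 1 + ‖x‖ ^ 2 := by
  refine isBigO_of_le _ fun x => ?_
  rw [Real.norm_of_nonneg (r := 1 + ‖x‖ ^ 2) (by positivity)]
  nlinarith [PiLp.norm_apply_le x i, sq_nonneg (‖x‖ - 1)]

theorem isBigO_coord_mul_coord (i j : Fin n) :
    (fun x : Vec n => x i * x j) =O[⊤] fun x => 1 + ‖x‖ ^ 2 := by
  refine isBigO_of_le _ fun x => ?_
  rw [norm_mul, Real.norm_of_nonneg (r := 1 + ‖x‖ ^ 2) (by positivity)]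
  calc ‖x i‖ * ‖x j‖ ≤ ‖x‖ * ‖x‖ := by gcongr <;> exact PiLp.norm_apply_le x _
    _ ≤ 1 + ‖x‖ ^ 2 := by rw [sq]; exact le_add_of_nonneg_left zero_le_one

theorem isBigO_suff : (suff : Vec n → GParam n →L[ℝ] ℝ) =O[⊤] fun x => 1 + ‖x‖ ^ 2 := by
  have hsmul {a : Vec n → ℝ} (ha : a =O[⊤] fun x => 1 + ‖x‖ ^ 2) (L : GParam n →L[ℝ] ℝ) :
      (fun x => a x • L) =O[⊤] fun x => 1 + ‖x‖ ^ 2 :=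
    ((ContinuousLinearMap.toSpanSingleton ℝ L).isBigO_comp a ⊤).trans ha
  exact (IsBigO.fun_sum fun i _ => hsmul (isBigO_coord i) _).add
    (IsBigO.fun_sum fun i _ => IsBigO.fun_sum fun j _ => hsmul (isBigO_coord_mul_coord i j) _)

/-- The `i`th partial derivative of `x ↦ suff x θ`. -/
def suffGrad (θ : GParam n) (i : Fin n) (x : Vec n) : ℝ := θ.gam i + 2 * ∑ j, θ.Gam i j * x j

theorem partialDeriv_suff (θ : GParam n) (i : Fin n) :
    partialDeriv i (fun x : Vec n => suff x θ) = suffGrad θ i := by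
  ext x
  have hlinear := HasFDerivAt.fun_sum (u := Finset.univ) fun j _ =>
    (hasFDerivAt_coord j x).mul_const (θ.gam j)
  have hquad := HasFDerivAt.fun_sum (u := Finset.univ) fun j _ =>
    HasFDerivAt.fun_sum (u := Finset.univ) fun k _ =>
      ((hasFDerivAt_coord j x).fun_mul (hasFDerivAt_coord k x)).mul_const (θ.Gam j k)
  simp only [partialDeriv, suff_apply, (hlinear.fun_add hquad).fderiv]
  suffices h : ∑ j, ∑ k, ((if k = i then θ.Gam j k * x j else 0) +
      if j = i then θ.Gam j k * x k else 0) = 2 * ∑ j, θ.Gam i j * x j by simpa [suffGrad] using h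
  have hrow : ∑ j, ∑ k, (if j = i then θ.Gam j k * x k else 0) = ∑ k, θ.Gam i k * x k := by
    rw [Finset.sum_comm]; simp
  simp only [Finset.sum_add_distrib, hrow, Finset.sum_ite_eq', Finset.mem_univ, if_true,
    Gam_symm θ _ i, two_mul]

theorem partialDeriv_suffGrad (θ : GParam n) (i j : Fin n) (x : Vec n) :
    partialDeriv j (suffGrad θ i) x = 2 * θ.Gam i j := by
  have hderiv := ((HasFDerivAt.fun_sum fun k (_ : k ∈ Finset.univ) =>
    (hasFDerivAt_coord k x).const_mul (θ.Gam i k)).const_mul 2).const_add (θ.gam i)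
  unfold suffGrad
  rw [partialDeriv, hderiv.fderiv]
  simp

theorem moderateGrowth_suff (v : GParam n) : ModerateGrowth fun x : Vec n => suff x v :=
  (ModerateGrowth.of_isBigO_one_add_norm_sq continuous_suff isBigO_suff).clm_apply v

theorem moderateGrowth_coord (i : Fin n) : ModerateGrowth fun x : Vec n => x i :=
  .of_isBigO_one_add_norm_sq (by fun_prop) (isBigO_coord i)

theorem moderateGrowth_suffGrad (θ : GParam n) (i : Fin n) : ModerateGrowth (suffGrad θ i) :=
  (ModerateGrowth.const _).add ((ModerateGrowth.const 2).mul
    (ModerateGrowth.sum _ fun j _ => (ModerateGrowth.const _).mul (moderateGrowth_coord j)))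

theorem moderateGrowthC2_suff_add_const (θ : GParam n) (c : ℝ) :
    ModerateGrowthC2 fun x : Vec n => suff x θ + c := by
  have hfst (i : Fin n) : partialDeriv i (fun x : Vec n => suff x θ + c) = suffGrad θ i := by
    rw [← partialDeriv_suff]
    ext x
    simp [partialDeriv, fderiv_add_const]
  have hsnd (i j : Fin n) :
      partialDeriv j (partialDeriv i fun x : Vec n => suff x θ + c) = fun _ => 2 * θ.Gam i j := by
    ext x; rw [hfst, partialDeriv_suffGrad]
  refine ⟨?_, (moderateGrowth_suff θ).add (.const c), fun i => ?_, fun i j => ?_⟩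
  · simp only [suff_apply]; fun_prop
  · rw [hfst]; exact moderateGrowth_suffGrad θ i
  · rw [hsnd]; exact .const _

/-- The natural parameters of the Gaussians with a positive definite covariance. -/
def gAdmissible (n : ℕ) : Set (GParam n) := {θ | (-θ.Gam).PosDef}

theorem isOpen_gAdmissible : IsOpen (gAdmissible n) := by
  refine isOpen_setOf_posDef ?_ fun θ => ?_
  · unfold GParam.Gam
    exact (continuous_matrix fun i j => continuous_apply (A := fun _ => ℝ) _).neg
  · ext i j; simp [Gam_symm θ i j]

variable {θ : GParam n}

theorem posDef_neg_two_smul_Gam (h : θ ∈ gAdmissible n) : ((-2 : ℝ) • θ.Gam).PosDef := by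
  simpa using Matrix.PosDef.smul h (a := (2 : ℝ)) two_pos

theorem isUnit_det_Gam (h : θ ∈ gAdmissible n) : IsUnit θ.Gam.det := by
  have hdet := (Matrix.PosDef.det_pos h).ne'
  rw [Matrix.det_neg] at hdet
  exact (right_ne_zero_of_mul hdet).isUnit

theorem inv_cov (h : θ ∈ gAdmissible n) : θ.cov⁻¹ = (-2 : ℝ) • θ.Gam :=
  Matrix.nonsing_inv_nonsing_inv _ (posDef_neg_two_smul_Gam h).det_pos.ne'.isUnit

theorem det_cov (θ : GParam n) : θ.cov.det = ((-2 : ℝ) • θ.Gam).det⁻¹ := by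
  rw [GParam.cov, Matrix.det_nonsing_inv, Ring.inverse_eq_inv']

theorem neg_two_smul_Gam_mulVec_mean (h : θ ∈ gAdmissible n) :
    ((-2 : ℝ) • θ.Gam) *ᵥ θ.mean = θ.gam := by
  rw [GParam.mean, GParam.cov, Matrix.mulVec_mulVec,
    Matrix.mul_nonsing_inv _ (posDef_neg_two_smul_Gam h).det_pos.ne'.isUnit, Matrix.one_mulVec]

theorem mean_eq_inv_Gam_mulVec_gam (h : θ ∈ gAdmissible n) :
    θ.mean = -(1 / 2 : ℝ) • (θ.Gam⁻¹ *ᵥ θ.gam) := by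
  rw [← neg_two_smul_Gam_mulVec_mean h, Matrix.smul_mulVec, Matrix.mulVec_smul,
    Matrix.mulVec_mulVec, Matrix.nonsing_inv_mul _ (isUnit_det_Gam h), Matrix.one_mulVec, smul_smul]
  norm_num

/-- The log-partition function of the Gaussian. -/
def logZ (θ : GParam n) : ℝ :=
  1 / 2 * (n * Real.log (2 * Real.pi) - Real.log ((-2 : ℝ) • θ.Gam).det)
    + 1 / 2 * (θ.gam ⬝ᵥ (θ.cov *ᵥ θ.gam))

theorem neg_half_quadratic_sub_mean (hθ : θ ∈ gAdmissible n) (x : Vec n) :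
    -(1 / 2) * ((fun i => x i - θ.mean i) ⬝ᵥ (((-2 : ℝ) • θ.Gam) *ᵥ fun i => x i - θ.mean i))
      = suff x θ - 1 / 2 * (θ.gam ⬝ᵥ (θ.cov *ᵥ θ.gam)) := by
  have hsymm : ((-2 : ℝ) • θ.Gam)ᵀ = (-2 : ℝ) • θ.Gam := by ext i j; simp [Gam_symm θ i j]
  have hcross : θ.mean ⬝ᵥ (((-2 : ℝ) • θ.Gam) *ᵥ x.ofLp) = x.ofLp ⬝ᵥ θ.gam := by
    rw [Matrix.dotProduct_mulVec, ← Matrix.mulVec_transpose, hsymm,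
      neg_two_smul_Gam_mulVec_mean hθ, dotProduct_comm]
  have hsuff : suff x θ = x.ofLp ⬝ᵥ θ.gam + x.ofLp ⬝ᵥ (θ.Gam *ᵥ x.ofLp) := by
    rw [suff_apply, dotProduct_mulVec_eq_sum]; rfl
  change -(1 / 2) * ((x.ofLp - θ.mean) ⬝ᵥ (((-2 : ℝ) • θ.Gam) *ᵥ (x.ofLp - θ.mean))) = _
  rw [Matrix.mulVec_sub, neg_two_smul_Gam_mulVec_mean hθ, sub_dotProduct, dotProduct_sub,
    dotProduct_sub, hcross, hsuff, Matrix.smul_mulVec, dotProduct_smul, dotProduct_comm θ.mean,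
    ← GParam.mean, smul_eq_mul]
  ring

theorem natGauss_eq_exp (hθ : θ ∈ gAdmissible n) (x : Vec n) :
    natGauss θ x = Real.exp (suff x θ - logZ θ) := by
  have hdet := (posDef_neg_two_smul_Gam hθ).det_pos
  have hnorm : (√((2 * Real.pi) ^ n * ((-2 : ℝ) • θ.Gam).det⁻¹))⁻¹ =
      Real.exp (-(1 / 2 * (n * Real.log (2 * Real.pi) - Real.log ((-2 : ℝ) • θ.Gam).det))) := by
    have hpos : 0 < (2 * Real.pi) ^ n * ((-2 : ℝ) • θ.Gam).det⁻¹ := by positivity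
    rw [Real.exp_neg, ← Real.exp_log (Real.sqrt_pos.2 hpos), Real.log_sqrt hpos.le,
      Real.log_mul (by positivity) (by positivity), Real.log_pow, Real.log_inv]
    ring_nf
  rw [natGauss, gaussPDF, inv_cov hθ, neg_half_quadratic_sub_mean hθ, det_cov, hnorm,
    ← Real.exp_add, logZ]
  ring_nf

theorem integral_natGauss (hθ : θ ∈ gAdmissible n) : ∫ x, natGauss θ x = 1 := by
  have hdet := (posDef_neg_two_smul_Gam hθ).det_pos
  simp only [natGauss, gaussPDF, inv_cov hθ, det_cov]
  rw [integral_const_mul, integral_exp_neg_half_quadratic (posDef_neg_two_smul_Gam hθ),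
    Fintype.card_fin, div_eq_mul_inv]
  exact inv_mul_cancel₀ (Real.sqrt_pos.2 (by positivity)).ne'

theorem natGauss_pos (hθ : θ ∈ gAdmissible n) (x : Vec n) : 0 < natGauss θ x := by
  rw [natGauss_eq_exp hθ]; exact Real.exp_pos _

theorem integrable_natGauss (hθ : θ ∈ gAdmissible n) : Integrable (natGauss θ) :=
  .of_integral_ne_zero (by rw [integral_natGauss hθ]; exact one_ne_zero)

theorem contDiffAt_logZ (hθ : θ ∈ gAdmissible n) : ContDiffAt ℝ 1 logZ θ := by
  have hdet := (posDef_neg_two_smul_Gam hθ).det_pos.ne'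
  have hprec (i j : Fin n) : ContDiffAt ℝ 1 (fun θ : GParam n => ((-2 : ℝ) • θ.Gam) i j) θ := by
    simp only [Matrix.smul_apply, GParam.Gam, Matrix.of_apply]
    fun_prop
  have hcov (i j : Fin n) := contDiffAt_inv_apply hprec hdet i j
  have hgam (i : Fin n) : ContDiffAt ℝ 1 (fun θ : GParam n => θ.gam i) θ := by
    unfold GParam.gam; fun_prop
  unfold logZ
  simp only [dotProduct, Matrix.mulVec]
  exact (contDiffAt_const.mul (contDiffAt_const.sub ((contDiffAt_det hprec).log hdet))).add
    (contDiffAt_const.mul (ContDiffAt.sum fun i _ =>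
      (hgam i).mul (ContDiffAt.sum fun j _ => (hcov i j).mul (hgam j))))

/-- The direction in parameter space that adds the identity to `Γ`. -/
def idShift (n : ℕ) : GParam n := Sum.elim 0 fun p => if p.1.1 = p.1.2 then 1 else 0

theorem suff_idShift (x : Vec n) : suff x (idShift n) = ‖x‖ ^ 2 := by
  have hGam (i j : Fin n) : (idShift n).Gam i j = if i = j then 1 else 0 := by
    rcases le_total i j with _ | _ <;> simp [idShift, GParam.Gam, eq_comm]
  have hgam (i : Fin n) : (idShift n).gam i = 0 := by simp [idShift, GParam.gam]
  rw [suff_apply, EuclideanSpace.norm_sq_eq]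
  simp [hGam, hgam, pow_two]

theorem natGauss_mul_eq (hθ : θ ∈ gAdmissible n) (f : Vec n → ℝ) (x : Vec n) :
    natGauss θ x * f x = Real.exp (-logZ θ) * (Real.exp (suff x θ) * f x) := by
  rw [natGauss_eq_exp hθ, ← mul_assoc, ← Real.exp_add]; ring_nf

theorem integral_natGauss_mul (hθ : θ ∈ gAdmissible n) (f : Vec n → ℝ) :
    ∫ x, natGauss θ x * f x = Real.exp (-logZ θ) * ∫ x, Real.exp (suff x θ) * f x := by
  simp only [natGauss_mul_eq hθ, integral_const_mul]

theorem ExpIntegrable.integrable_natGauss_mul (hθ : θ ∈ gAdmissible n) {f : Vec n → ℝ}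
    (h : ExpIntegrable (suff · θ) f) : Integrable fun x => natGauss θ x * f x := by
  simpa only [natGauss_mul_eq hθ] using h.integrable.const_mul _

theorem expIntegrable_of_idShift {f : Vec n → ℝ} {ε : ℝ} (hε : 0 < ε)
    (hθ : θ + ε • idShift n ∈ gAdmissible n)
    (h : Integrable fun x => natGauss (θ + ε • idShift n) x * f x) :
    ExpIntegrable (suff · θ) f := by
  refine ⟨ε, hε, (h.const_mul (Real.exp (logZ (θ + ε • idShift n)))).congr
    (.of_forall fun x => ?_)⟩
  simp only [natGauss_mul_eq hθ, map_add, map_smul, suff_idShift, smul_eq_mul]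
  rw [← mul_assoc, ← Real.exp_add, add_neg_cancel, Real.exp_zero, one_mul]

theorem expIntegrable_one (hθ : θ ∈ gAdmissible n) : ExpIntegrable (suff · θ) fun _ => 1 := by
  have hcont : Continuous fun ε : ℝ => θ + ε • idShift n := by fun_prop
  have hnhds : ∀ᶠ ε in 𝓝 (0 : ℝ), θ + ε • idShift n ∈ gAdmissible n :=
    (hcont.tendsto' 0 θ (by simp)).eventually (isOpen_gAdmissible.mem_nhds hθ)
  obtain ⟨ε, hmem, hε⟩ := ((hnhds.filter_mono nhdsWithin_le_nhds).and
    (self_mem_nhdsWithin (s := Set.Ioi (0 : ℝ)))).exists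
  exact expIntegrable_of_idShift hε hmem (by simpa using integrable_natGauss hmem)

end Gaussian

/-! ### Exponential families with statistics of quadratic growth -/

/-- An exponential family `exp (⟨stat x, θ⟩ - logPartition θ)` whose sufficient statistics are
continuous and grow at most quadratically. The densities need not be normalized. -/
structure QuadExpFamily (E P : Type*) [NormedAddCommGroup E] [NormedAddCommGroup P]
    [NormedSpace ℝ P] where
  stat : E → P →L[ℝ] ℝ
  logPartition : P → ℝ
  continuous_stat : Continuous stat
  isBigO_stat : stat =O[⊤] fun x => 1 + ‖x‖ ^ 2

namespace QuadExpFamily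

variable {E P : Type*} [NormedAddCommGroup E] [NormedAddCommGroup P] [NormedSpace ℝ P]
  (F : QuadExpFamily E P) {θ : P}

/-- The logarithm of the density of an exponential family. -/
def logDensity (θ : P) (x : E) : ℝ := F.stat x θ - F.logPartition θ

/-- The density of an exponential family. -/
def density (θ : P) (x : E) : ℝ := Real.exp (F.logDensity θ x)

/-- The score, i.e. the derivative of the log-density in the parameter. -/
def score (θ : P) (x : E) : P →L[ℝ] ℝ := F.stat x - fderiv ℝ F.logPartition θ

theorem density_pos (θ : P) (x : E) : 0 < F.density θ x := Real.exp_pos _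

theorem continuous_logDensity (θ : P) : Continuous (F.logDensity θ) :=
  (F.continuous_stat.clm_apply continuous_const).sub continuous_const

theorem continuous_density (θ : P) : Continuous (F.density θ) := (F.continuous_logDensity θ).rexp

theorem continuous_score (θ : P) : Continuous (F.score θ) :=
  F.continuous_stat.sub continuous_const

variable {F}

theorem hasFDerivAt_logDensity (h : DifferentiableAt ℝ F.logPartition θ) (x : E) :
    HasFDerivAt (F.logDensity · x) (F.score θ x) θ :=
  (F.stat x).hasFDerivAt.fun_sub h.hasFDerivAt

theorem hasFDerivAt_density (h : DifferentiableAt ℝ F.logPartition θ) (x : E) :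
    HasFDerivAt (F.density · x) (F.density θ x • F.score θ x) θ :=
  (hasFDerivAt_logDensity h x).exp

theorem moderateGrowth_score_apply (θ v : P) : ModerateGrowth fun x => F.score θ x v :=
  ((ModerateGrowth.of_isBigO_one_add_norm_sq F.continuous_stat F.isBigO_stat).sub
    (.const _)).clm_apply v

theorem exists_norm_stat_le (F : QuadExpFamily E P) :
    ∃ C, 0 < C ∧ ∀ x, ‖F.stat x‖ ≤ C * (1 + ‖x‖ ^ 2) := by
  obtain ⟨C, hC, h⟩ := F.isBigO_stat.exists_pos
  refine ⟨C, hC, fun x => (isBigOWith_top.1 h x).trans_eq ?_⟩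
  rw [Real.norm_of_nonneg (by positivity)]

theorem eventually_density_le (hZ : ContinuousAt F.logPartition θ) {δ : ℝ} (hδ : 0 < δ) :
    ∃ C, ∀ᶠ θ' in 𝓝 θ, ∀ x, F.density θ' x ≤ C * Real.exp (F.stat x θ + δ * ‖x‖ ^ 2) := by
  obtain ⟨C, hC, hstat⟩ := F.exists_norm_stat_le
  refine ⟨Real.exp (δ - (F.logPartition θ - 1)), ?_⟩
  filter_upwards [Metric.ball_mem_nhds θ (div_pos hδ hC),
    hZ.eventually (lt_mem_nhds (sub_one_lt _))] with θ' hball hlog x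
  have hdiff : F.stat x (θ' - θ) ≤ δ * (1 + ‖x‖ ^ 2) :=
    calc F.stat x (θ' - θ) ≤ ‖F.stat x‖ * ‖θ' - θ‖ :=
          (Real.le_norm_self _).trans ((F.stat x).le_opNorm _)
      _ ≤ C * (1 + ‖x‖ ^ 2) * (δ / C) := by
          gcongr
          exacts [hstat x, (mem_ball_iff_norm.1 hball).le]
      _ = δ * (1 + ‖x‖ ^ 2) := by field_simp
  rw [map_sub] at hdiff
  rw [density, logDensity, ← Real.exp_add, Real.exp_le_exp]
  linarith

theorem eventually_norm_score_le (hZ : ContinuousAt (fderiv ℝ F.logPartition) θ) :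
    ∃ C, ∀ᶠ θ' in 𝓝 θ, ∀ x, ‖F.score θ' x‖ ≤ C * (1 + ‖x‖ ^ 2) := by
  obtain ⟨C, -, hstat⟩ := F.exists_norm_stat_le
  refine ⟨C + (‖fderiv ℝ F.logPartition θ‖ + 1), ?_⟩
  filter_upwards [hZ.norm.eventually (gt_mem_nhds (lt_add_one _))] with θ' hθ' x
  calc ‖F.score θ' x‖ ≤ ‖F.stat x‖ + ‖fderiv ℝ F.logPartition θ'‖ := norm_sub_le _ _
    _ ≤ C * (1 + ‖x‖ ^ 2) + (‖fderiv ℝ F.logPartition θ‖ + 1) * (1 + ‖x‖ ^ 2) := by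
        refine add_le_add (hstat x) (hθ'.le.trans (le_mul_of_one_le_right (by positivity) ?_))
        exact le_add_of_nonneg_right (by positivity)
    _ = _ := by ring

theorem eventually_abs_logDensity_le (hZ : ContinuousAt F.logPartition θ) :
    ∃ C, ∀ᶠ θ' in 𝓝 θ, ∀ x, |F.logDensity θ' x| ≤ C * (1 + ‖x‖ ^ 2) := by
  obtain ⟨C, hC, hstat⟩ := F.exists_norm_stat_le
  refine ⟨C * (‖θ‖ + 1) + (|F.logPartition θ| + 1), ?_⟩
  filter_upwards [continuous_norm.continuousAt.eventually (gt_mem_nhds (lt_add_one _)),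
    hZ.abs.eventually (gt_mem_nhds (lt_add_one _))] with θ' hnorm hlog x
  calc |F.logDensity θ' x| ≤ ‖F.stat x‖ * ‖θ'‖ + |F.logPartition θ'| :=
        (abs_sub _ _).trans (add_le_add_left ((F.stat x).le_opNorm θ') _)
    _ ≤ C * (1 + ‖x‖ ^ 2) * (‖θ‖ + 1) + (|F.logPartition θ| + 1) * (1 + ‖x‖ ^ 2) := by
        refine add_le_add (by gcongr; exact hstat x)
          (hlog.le.trans (le_mul_of_one_le_right (by positivity) ?_))
        exact le_add_of_nonneg_right (by positivity)
    _ = _ := by ring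

variable [MeasureSpace E]

/-- Differentiability of `h` in the parameter with the local bounds that allow
`θ ↦ ∫ x, density θ x * h θ x` to be differentiated at `θ` under the integral sign. -/
structure DominatedAt (F : QuadExpFamily E P) (h : P → E → ℝ) (h' : P → E → P →L[ℝ] ℝ)
    (θ : P) : Prop where
  continuous : ∀ᶠ θ' in 𝓝 θ, Continuous (h θ')
  continuous_deriv : Continuous (h' θ)
  hasFDerivAt_le : ∃ B, ExpIntegrable (F.stat · θ) B ∧ ∀ᶠ θ' in 𝓝 θ, ∀ x,
    HasFDerivAt (h · x) (h' θ' x) θ' ∧ ‖h θ' x‖ ≤ B x ∧ ‖h' θ' x‖ ≤ B x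

variable [BorelSpace E] {h : P → E → ℝ} {h' : P → E → P →L[ℝ] ℝ}

namespace DominatedAt

theorem exists_integrable_bound (hh : F.DominatedAt h h' θ)
    (hZ : ContDiffAt ℝ 1 F.logPartition θ) :
    ∃ b : E → ℝ, Integrable b ∧ ∀ᶠ θ' in 𝓝 θ, ∀ x, ‖F.density θ' x * h θ' x‖ ≤ b x ∧
      ‖F.density θ' x • (h θ' x • F.score θ' x + h' θ' x)‖ ≤ b x := by
  obtain ⟨B, hB, hle⟩ := hh.hasFDerivAt_le
  obtain ⟨D, hD⟩ := eventually_norm_score_le (hZ.continuousAt_fderiv one_ne_zero)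
  have hgrowth : ModerateGrowth fun x : E => |D| * (1 + ‖x‖ ^ 2) + 1 :=
    ((ModerateGrowth.const _).mul .one_add_norm_sq).add (.const 1)
  obtain ⟨δ, hδ, hint⟩ := hB.moderateGrowth_mul hgrowth
  obtain ⟨C, hC⟩ := eventually_density_le hZ.continuousAt hδ
  refine ⟨_, hint.const_mul C, ?_⟩
  filter_upwards [hle, hD, hC] with θ' hle hD hC x
  obtain ⟨-, hhB, hh'B⟩ := hle x
  have hBx : 0 ≤ B x := (norm_nonneg _).trans hhB
  have hbound : ∀ {a : ℝ}, a ≤ (|D| * (1 + ‖x‖ ^ 2) + 1) * B x → F.density θ' x * a ≤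
      C * (Real.exp (F.stat x θ + δ * ‖x‖ ^ 2) * ((|D| * (1 + ‖x‖ ^ 2) + 1) * B x)) :=
    fun {a} ha => by
      rw [← mul_assoc C]
      calc F.density θ' x * a
          ≤ F.density θ' x * ((|D| * (1 + ‖x‖ ^ 2) + 1) * B x) := by
            gcongr; exact (F.density_pos θ' x).le
        _ ≤ _ := by gcongr; exact hC x
  rw [norm_mul, norm_smul, Real.norm_of_nonneg (F.density_pos θ' x).le]
  refine ⟨hbound (hhB.trans (le_mul_of_one_le_left hBx ?_)), hbound ?_⟩
  · exact le_add_of_nonneg_left (by positivity)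
  · calc ‖h θ' x • F.score θ' x + h' θ' x‖ ≤ ‖h θ' x‖ * ‖F.score θ' x‖ + ‖h' θ' x‖ :=
          (norm_add_le _ _).trans_eq (by rw [norm_smul])
      _ ≤ B x * (|D| * (1 + ‖x‖ ^ 2)) + B x := by
          gcongr
          exact (hD x).trans (by gcongr; exact le_abs_self D)
      _ = _ := by ring

theorem eventually_integrable (hh : F.DominatedAt h h' θ)
    (hZ : ContDiffAt ℝ 1 F.logPartition θ) :
    ∀ᶠ θ' in 𝓝 θ, Integrable fun x => F.density θ' x * h θ' x := by
  obtain ⟨b, hb, hle⟩ := hh.exists_integrable_bound hZ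
  filter_upwards [hh.continuous, hle] with θ' hcont hle
  exact hb.mono' ((F.continuous_density θ').mul hcont).aestronglyMeasurable
    (.of_forall fun x => (hle x).1)

variable [SecondCountableTopology E]

theorem integrable_deriv (hh : F.DominatedAt h h' θ) (hZ : ContDiffAt ℝ 1 F.logPartition θ) :
    Integrable fun x => F.density θ x • (h θ x • F.score θ x + h' θ x) := by
  obtain ⟨b, hb, hle⟩ := hh.exists_integrable_bound hZ
  exact hb.mono' ((F.continuous_density θ).smul ((hh.continuous.self_of_nhds.smul
    (F.continuous_score θ)).add hh.continuous_deriv)).aestronglyMeasurable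
    (.of_forall fun x => (hle.self_of_nhds x).2)

theorem hasFDerivAt_integral (hh : F.DominatedAt h h' θ)
    (hZ : ContDiffAt ℝ 1 F.logPartition θ) :
    HasFDerivAt (fun θ => ∫ x, F.density θ x * h θ x)
      (∫ x, F.density θ x • (h θ x • F.score θ x + h' θ x)) θ := by
  obtain ⟨b, hb, hle⟩ := hh.exists_integrable_bound hZ
  obtain ⟨B, -, hderiv⟩ := hh.hasFDerivAt_le
  have hmeas : ∀ᶠ θ' in 𝓝 θ, AEStronglyMeasurable fun x => F.density θ' x * h θ' x :=
    hh.continuous.mono fun θ' hc => ((F.continuous_density θ').mul hc).aestronglyMeasurable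
  have hdiff : ∀ᶠ θ' in 𝓝 θ, ∀ x, HasFDerivAt (fun θ => F.density θ x * h θ x)
      (F.density θ' x • (h θ' x • F.score θ' x + h' θ' x)) θ' := by
    filter_upwards [hderiv, hZ.eventually (by simp)] with θ' hθ' hZ' x
    refine ((hasFDerivAt_density (hZ'.differentiableAt one_ne_zero) x).fun_mul
      (hθ' x).1).congr_fderiv ?_
    rw [smul_add, smul_comm, add_comm]
  exact hasFDerivAt_integral_of_dominated_of_fderiv_le (hle.and hdiff) hmeas
    (hh.eventually_integrable hZ).self_of_nhds
    (hh.integrable_deriv hZ).aestronglyMeasurable (.of_forall fun x θ' hθ' => (hθ'.1 x).2) hb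
    (.of_forall fun x θ' hθ' => hθ'.2 x)

theorem fderiv_integral_apply (hh : F.DominatedAt h h' θ)
    (hZ : ContDiffAt ℝ 1 F.logPartition θ) (v : P) :
    fderiv ℝ (fun θ => ∫ x, F.density θ x * h θ x) θ v =
      ∫ x, F.density θ x * (h θ x * F.score θ x v + h' θ x v) := by
  rw [(hh.hasFDerivAt_integral hZ).fderiv,
    ContinuousLinearMap.integral_apply (hh.integrable_deriv hZ)]
  rfl

end DominatedAt

theorem integral_density_mul_score_apply [SecondCountableTopology E]
    (hZ : ContDiffAt ℝ 1 F.logPartition θ)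
    (hone : ExpIntegrable (F.stat · θ) fun _ => 1) (hF : ∀ᶠ θ' in 𝓝 θ, ∫ x, F.density θ' x = 1)
    (v : P) : ∫ x, F.density θ x * F.score θ x v = 0 := by
  have hdom : F.DominatedAt (fun _ _ => 1) (fun _ _ => 0) θ :=
    ⟨.of_forall fun _ => continuous_const, continuous_const, _, hone, .of_forall fun θ' _ =>
      ⟨hasFDerivAt_const _ _, by simp, by simp⟩⟩
  have hconst : (fun θ => ∫ x, F.density θ x * 1) =ᶠ[𝓝 θ] fun _ => 1 := by
    filter_upwards [hF] with θ' hθ'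
    simpa only [mul_one] using hθ'
  have hfderiv := hdom.fderiv_integral_apply hZ v
  rw [hconst.fderiv_eq] at hfderiv
  simpa using hfderiv.symm

end QuadExpFamily

section Weight

variable {m : ℕ}

/-- The log-odds of the `k`th component as a linear functional of the free log-odds. -/
def logOddsL (k : Fin (m + 1)) : (Fin m → ℝ) →L[ℝ] ℝ :=
  Fin.lastCases (motive := fun _ => (Fin m → ℝ) →L[ℝ] ℝ) 0 (ContinuousLinearMap.proj ·) k

theorem logOddsL_apply (k : Fin (m + 1)) (w : Fin m → ℝ) : logOddsL k w = logOdds w k := by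
  refine Fin.lastCases ?_ (fun i => ?_) k <;> simp [logOddsL, logOdds]

theorem weight_eq_softmax (w : Fin m → ℝ) : weight w = softmax (logOdds w) := by
  ext k; rw [softmax_eq_div, weight]

theorem weight_pos (w : Fin m → ℝ) (k : Fin (m + 1)) : 0 < weight w k := by
  rw [weight_eq_softmax]; exact softmax_pos _ k

theorem sum_weight (w : Fin m → ℝ) : ∑ k, weight w k = 1 := by
  rw [weight_eq_softmax, sum_softmax]

theorem log_weight (w : Fin m → ℝ) (k : Fin (m + 1)) :
    Real.log (weight w k) = logOdds w k - logSumExp (logOdds w) := by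
  rw [weight_eq_softmax, softmax, Real.log_exp]

theorem contDiff_logSumExp_logOdds :
    ContDiff ℝ 1 fun w : Fin m → ℝ => logSumExp (logOdds w) :=
  contDiff_logSumExp.comp <| contDiff_pi.2 fun k =>
    (funext (logOddsL_apply k) : _ = fun w : Fin m → ℝ => logOdds w k) ▸ (logOddsL k).contDiff

theorem hasFDerivAt_logSumExp_logOdds (w : Fin m → ℝ) :
    HasFDerivAt (fun w => logSumExp (logOdds w)) (∑ k, weight w k • logOddsL k) w := by
  have hodds : HasFDerivAt logOdds (ContinuousLinearMap.pi logOddsL) w :=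
    hasFDerivAt_pi.2 fun k => (logOddsL k).hasFDerivAt.congr_of_eventuallyEq
      (.of_forall fun w => (logOddsL_apply k w).symm)
  refine ((hasFDerivAt_logSumExp (logOdds w)).comp w hodds).congr_fderiv ?_
  ext v
  simp [weight_eq_softmax]

/-- The score of the component weights in the free log-odds. -/
def wscore (w : Fin m → ℝ) (k : Fin (m + 1)) : (Fin m → ℝ) →L[ℝ] ℝ :=
  logOddsL k - ∑ j, weight w j • logOddsL j

theorem hasFDerivAt_log_weight (w : Fin m → ℝ) (k : Fin (m + 1)) :
    HasFDerivAt (fun w => Real.log (weight w k)) (wscore w k) w := by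
  simp only [log_weight, ← logOddsL_apply k]
  exact (logOddsL k).hasFDerivAt.fun_sub (hasFDerivAt_logSumExp_logOdds w)

theorem sum_weight_mul_wscore_apply (w v : Fin m → ℝ) : ∑ k, weight w k * wscore w k v = 0 := by
  have hsplit (k : Fin (m + 1)) : weight w k * wscore w k v =
      weight w k * logOdds v k - weight w k * ∑ j, weight w j * logOdds v j := by
    simp [wscore, logOddsL_apply, mul_sub]
  simp only [hsplit, Finset.sum_sub_distrib, ← Finset.sum_mul, sum_weight, one_mul, sub_self]

theorem eq_zero_of_wscore_apply_eq_zero {w v : Fin m → ℝ} (h : ∀ k, wscore w k v = 0) :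
    v = 0 := by
  have hlogOdds (k : Fin (m + 1)) : logOdds v k = logOdds v (Fin.last m) := by
    have hk := (h k).trans (h (Fin.last m)).symm
    simpa only [wscore, sub_apply, sub_left_inj, logOddsL_apply] using hk
  ext i
  simpa [logOdds] using hlogOdds i.castSucc

end Weight

/-! ### The joint family of state and component label -/

section Joint

variable {n m : ℕ}

/-- The Gaussian densities in natural parameters as an exponential family. -/
def gaussFamily (n : ℕ) : QuadExpFamily (Vec n) (GParam n) where
  stat := suff
  logPartition := logZ
  continuous_stat := continuous_suff
  isBigO_stat := isBigO_suff

theorem gaussFamily_density {θ : GParam n} (hθ : θ ∈ gAdmissible n) :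
    (gaussFamily n).density θ = natGauss θ :=
  funext fun x => (natGauss_eq_exp hθ x).symm

theorem gaussFamily_score_apply (θ v : GParam n) (x : Vec n) :
    (gaussFamily n).score θ x v = suff x v - fderiv ℝ logZ θ v :=
  rfl

theorem hasFDerivAt_log_natGauss {θ : GParam n} (hθ : θ ∈ gAdmissible n) (x : Vec n) :
    HasFDerivAt (fun θ => Real.log (natGauss θ x)) ((gaussFamily n).score θ x) θ := by
  refine (QuadExpFamily.hasFDerivAt_logDensity
    ((contDiffAt_logZ hθ).differentiableAt one_ne_zero) x).congr_of_eventuallyEq ?_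
  filter_upwards [isOpen_gAdmissible.mem_nhds hθ] with θ' hθ'
  rw [natGauss_eq_exp hθ', Real.log_exp]
  rfl

theorem integral_natGauss_mul_score_apply {θ : GParam n} (hθ : θ ∈ gAdmissible n)
    (v : GParam n) : ∫ x, natGauss θ x * (gaussFamily n).score θ x v = 0 := by
  rw [← gaussFamily_density hθ]
  refine QuadExpFamily.integral_density_mul_score_apply (F := gaussFamily n) (contDiffAt_logZ hθ)
    (expIntegrable_one hθ) ?_ v
  filter_upwards [isOpen_gAdmissible.mem_nhds hθ] with θ' hθ'
  rw [gaussFamily_density hθ', integral_natGauss hθ']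

/-- The projection of the mixture parameters to those of the `k`th component. -/
def compL (k : Fin (m + 1)) : MParam n m →L[ℝ] GParam n :=
  ContinuousLinearMap.pi fun a => ContinuousLinearMap.proj (Sum.inl (a, k))

/-- The projection of the mixture parameters to the free log-odds. -/
def oddsL : MParam n m →L[ℝ] (Fin m → ℝ) :=
  ContinuousLinearMap.pi fun k => ContinuousLinearMap.proj (Sum.inr k)

theorem compL_apply (k : Fin (m + 1)) (η : MParam n m) : compL k η = η.comp k := rfl

theorem oddsL_apply (η : MParam n m) : oddsL η = η.odds := rfl

theorem isOpen_admissible : IsOpen (admissible n m) := by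
  simp only [admissible, Set.ofPred_forall]
  exact isOpen_iInter_of_finite fun k => isOpen_gAdmissible.preimage (compL k).continuous

/-- The densities `x ↦ q(x, ω = k; η)` as an exponential family, for a fixed label `k`. -/
def jointFamily (n : ℕ) {m : ℕ} (k : Fin (m + 1)) : QuadExpFamily (Vec n) (MParam n m) where
  stat x := suff x ∘L compL k + logOddsL k ∘L oddsL
  logPartition η := logZ (η.comp k) + logSumExp (logOdds η.odds)
  continuous_stat := (continuous_suff.clm_comp continuous_const).add continuous_const
  isBigO_stat := (IsBigO.of_bound ‖(compL k : MParam n m →L[ℝ] GParam n)‖ (.of_forall fun x =>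
      ((suff x).opNorm_comp_le _).trans_eq (mul_comm _ _))).trans isBigO_suff |>.add
    (isBigO_const_one_add_norm_sq _)

variable {η : MParam n m}

theorem jointFamily_stat_apply (k : Fin (m + 1)) (x : Vec n) (η : MParam n m) :
    (jointFamily n k).stat x η = suff x (η.comp k) + logOdds η.odds k := by
  rw [← logOddsL_apply]; rfl

theorem jointQ_pos (hη : η ∈ admissible n m) (y : Vec n × Fin (m + 1)) : 0 < jointQ η y :=
  mul_pos (natGauss_pos (hη y.2) _) (weight_pos _ _)

theorem log_jointQ (hη : η ∈ admissible n m) (x : Vec n) (k : Fin (m + 1)) :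
    Real.log (jointQ η (x, k)) = (jointFamily n k).logDensity η x := by
  rw [jointQ, Real.log_mul (natGauss_pos (hη k) x).ne' (weight_pos _ _).ne', log_weight,
    natGauss_eq_exp (hη k), Real.log_exp, QuadExpFamily.logDensity, jointFamily_stat_apply]
  simp only [jointFamily]
  ring

theorem jointFamily_density (hη : η ∈ admissible n m) (k : Fin (m + 1)) (x : Vec n) :
    (jointFamily n k).density η x = jointQ η (x, k) := by
  rw [QuadExpFamily.density, ← log_jointQ hη, Real.exp_log (jointQ_pos hη _)]

theorem contDiffAt_jointFamily_logPartition (hη : η ∈ admissible n m) (k : Fin (m + 1)) :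
    ContDiffAt ℝ 1 (jointFamily n k).logPartition η :=
  (ContDiffAt.comp η (contDiffAt_logZ (hη k)) (compL k).contDiff.contDiffAt).add
    (contDiff_logSumExp_logOdds.comp oddsL.contDiff).contDiffAt

theorem jointFamily_score_apply (hη : η ∈ admissible n m) (k : Fin (m + 1)) (x : Vec n)
    (v : MParam n m) : (jointFamily n k).score η x v =
      (gaussFamily n).score (η.comp k) x (v.comp k) + wscore η.odds k v.odds := by
  have hlogZ : HasFDerivAt (fun η : MParam n m => logZ (η.comp k))
      (fderiv ℝ logZ (η.comp k) ∘L compL k) η :=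
    HasFDerivAt.comp (g := logZ) η
      ((contDiffAt_logZ (hη k)).differentiableAt one_ne_zero).hasFDerivAt (compL k).hasFDerivAt
  have hlse : HasFDerivAt (fun η : MParam n m => logSumExp (logOdds η.odds))
      ((∑ j, weight η.odds j • logOddsL j) ∘L oddsL) η :=
    (hasFDerivAt_logSumExp_logOdds _).comp η oddsL.hasFDerivAt
  have hderiv : fderiv ℝ (jointFamily n k).logPartition η = _ := (hlogZ.add hlse).fderiv
  rw [QuadExpFamily.score, sub_apply, jointFamily_stat_apply, hderiv,
    gaussFamily_score_apply, wscore, sub_apply, logOddsL_apply]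
  simp only [add_apply, ContinuousLinearMap.comp_apply, compL_apply,
    oddsL_apply]
  ring

theorem hasFDerivAt_log_jointQ (hη : η ∈ admissible n m) (x : Vec n) (k : Fin (m + 1)) :
    HasFDerivAt (fun η => Real.log (jointQ η (x, k))) ((jointFamily n k).score η x) η := by
  refine (QuadExpFamily.hasFDerivAt_logDensity
    ((contDiffAt_jointFamily_logPartition hη k).differentiableAt one_ne_zero)
      x).congr_of_eventuallyEq ?_
  filter_upwards [isOpen_admissible.mem_nhds hη] with η' hη'
  exact log_jointQ hη' x k

theorem integral_jointQ_mul (η : MParam n m) (k : Fin (m + 1)) (f : Vec n → ℝ) :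
    ∫ x, jointQ η (x, k) * f x = weight η.odds k * compE η k f := by
  rw [compE, ← integral_const_mul]
  simp only [jointQ, mul_comm, mul_assoc]

theorem expIntegrable_jointFamily_stat_iff (k : Fin (m + 1)) {f : Vec n → ℝ} :
    ExpIntegrable ((jointFamily n k).stat · η) f ↔ ExpIntegrable (suff · (η.comp k)) f := by
  refine exists_congr fun ε => and_congr_right fun _ => ?_
  rw [← integrable_const_mul_iff (Real.exp_pos (logOdds η.odds k)).ne'.isUnit
    (fun x => Real.exp (suff x _ + _) * _)]
  simp only [jointFamily_stat_apply, ← mul_assoc, ← Real.exp_add, add_comm (logOdds _ _),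
    add_right_comm]

end Joint

/-! ### Stein's identity -/

section Stein

variable {n : ℕ} {θ : GParam n} {f : Vec n → ℝ}

theorem integral_natGauss_mul_partialDeriv (hθ : θ ∈ gAdmissible n) (hf : Differentiable ℝ f)
    (hint : ExpIntegrable (suff · θ) f) (i : Fin n)
    (hderiv : ExpIntegrable (suff · θ) (partialDeriv i f)) :
    ∫ x, natGauss θ x * partialDeriv i f x = -∫ x, natGauss θ x * (suffGrad θ i x * f x) := by
  have hsuff : Differentiable ℝ fun x : Vec n => suff x θ := by
    simpa only [add_zero] using
      (moderateGrowthC2_suff_add_const θ 0).contDiff.differentiable two_ne_zero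
  have hexp (x : Vec n) : fderiv ℝ (fun y : Vec n => Real.exp (suff y θ)) x
      (EuclideanSpace.single i 1) * f x = Real.exp (suff x θ) * (suffGrad θ i x * f x) := by
    rw [← mul_assoc, ← partialDeriv_suff, ← partialDeriv_exp (hsuff x), partialDeriv]
  have hparts := integral_mul_fderiv_eq_neg_fderiv_mul_of_integrable
    (μ := (volume : Measure (Vec n))) (f := fun x => Real.exp (suff x θ)) (g := f)
    (v := EuclideanSpace.single i 1)
    (by simpa only [hexp] using (hint.moderateGrowth_mul (moderateGrowth_suffGrad θ i)).integrable)
    hderiv.integrable hint.integrable (fun x _ => (hsuff x).exp) fun x _ => hf x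
  simp only [hexp] at hparts
  rw [integral_natGauss_mul hθ, integral_natGauss_mul hθ, ← mul_neg, ← hparts]
  rfl

theorem coord_eq_mean_sub_sum_cov_mul_suffGrad (hθ : θ ∈ gAdmissible n) (x : Vec n) (i : Fin n) :
    x i = θ.mean i - ∑ j, θ.cov i j * suffGrad θ j x := by
  have hgrad : (fun j => suffGrad θ j x) = θ.gam - ((-2 : ℝ) • θ.Gam) *ᵥ x.ofLp := by
    ext j; simp [suffGrad, Matrix.mulVec, dotProduct, Finset.mul_sum, mul_assoc]
  have hcov : θ.cov *ᵥ (((-2 : ℝ) • θ.Gam) *ᵥ x.ofLp) = x.ofLp := by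
    rw [Matrix.mulVec_mulVec, GParam.cov, Matrix.nonsing_inv_mul _
      (posDef_neg_two_smul_Gam hθ).det_pos.ne'.isUnit, Matrix.one_mulVec]
  change x.ofLp i = θ.mean i - (θ.cov *ᵥ fun j => suffGrad θ j x) i
  rw [hgrad, Matrix.mulVec_sub, hcov, ← GParam.mean, Pi.sub_apply, sub_sub_cancel]

theorem integral_natGauss_mul_coord_mul (hθ : θ ∈ gAdmissible n) (hf : Differentiable ℝ f)
    (hint : ExpIntegrable (suff · θ) f)
    (hderiv : ∀ i, ExpIntegrable (suff · θ) (partialDeriv i f)) (i : Fin n) :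
    ∫ x, natGauss θ x * (x i * f x) = θ.mean i * (∫ x, natGauss θ x * f x) +
      ∑ j, θ.cov i j * ∫ x, natGauss θ x * partialDeriv j f x := by
  have hgrad (j : Fin n) : Integrable fun x => natGauss θ x * (suffGrad θ j x * f x) :=
    (hint.moderateGrowth_mul (moderateGrowth_suffGrad θ j)).integrable_natGauss_mul hθ
  have hexpand (x : Vec n) : natGauss θ x * (x i * f x) = θ.mean i * (natGauss θ x * f x) -
      ∑ j, θ.cov i j * (natGauss θ x * (suffGrad θ j x * f x)) := by
    rw [coord_eq_mean_sub_sum_cov_mul_suffGrad hθ x i, sub_mul, Finset.sum_mul, mul_sub,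
      Finset.mul_sum]
    congr 1
    · ring
    · exact Finset.sum_congr rfl fun j _ => by ring
  simp only [hexpand]
  rw [integral_sub ((hint.integrable_natGauss_mul hθ).const_mul _)
    (integrable_finsetSum _ fun j _ => (hgrad j).const_mul _),
    integral_finsetSum _ fun j _ => (hgrad j).const_mul _]
  simp only [integral_const_mul,
    integral_natGauss_mul_partialDeriv hθ hf hint _ (hderiv _), mul_neg, Finset.sum_neg_distrib,
    sub_eq_add_neg]

theorem integral_natGauss_mul_coord (hθ : θ ∈ gAdmissible n) (i : Fin n) :
    ∫ x, natGauss θ x * x i = θ.mean i := by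
  have hone := expIntegrable_one hθ
  have h := integral_natGauss_mul_coord_mul hθ (f := fun _ => 1) (differentiable_const _) hone
    (fun j => by
      rw [show partialDeriv j (fun _ : Vec n => (1 : ℝ)) = fun _ => 0 * 1 from
        funext fun x => by rw [partialDeriv_const, zero_mul]]
      exact hone.const_mul 0) i
  simpa [partialDeriv_const, integral_natGauss hθ] using h

theorem integral_natGauss_mul_suffGrad (hθ : θ ∈ gAdmissible n) (v : GParam n) (i : Fin n) :
    ∫ x, natGauss θ x * suffGrad v i x = v.gam i + 2 * (v.Gam *ᵥ θ.mean) i := by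
  have hcoord (j : Fin n) : Integrable fun x => natGauss θ x * x j :=
    ((moderateGrowth_coord j).expIntegrable (expIntegrable_one hθ)).integrable_natGauss_mul hθ
  have hexpand (x : Vec n) : natGauss θ x * suffGrad v i x =
      v.gam i * natGauss θ x + ∑ j, 2 * v.Gam i j * (natGauss θ x * x j) := by
    rw [suffGrad, mul_add, Finset.mul_sum, Finset.mul_sum, mul_comm]
    congr 1
    exact Finset.sum_congr rfl fun j _ => by ring
  simp only [hexpand]
  rw [integral_add ((integrable_natGauss hθ).const_mul _)
    (integrable_finsetSum _ fun j _ => (hcoord j).const_mul _),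
    integral_finsetSum _ fun j _ => (hcoord j).const_mul _]
  simp only [integral_const_mul, integral_natGauss hθ, integral_natGauss_mul_coord hθ, mul_one,
    Matrix.mulVec, dotProduct, Finset.mul_sum, mul_assoc]

theorem integral_natGauss_mul_coord_mul_eq_zero (hθ : θ ∈ gAdmissible n)
    (hf : Differentiable ℝ f) (hint : ExpIntegrable (suff · θ) f)
    (hderiv : ∀ i, ExpIntegrable (suff · θ) (partialDeriv i f))
    (hzero : ∫ x, natGauss θ x * f x = 0)
    (hzero' : ∀ i, ∫ x, natGauss θ x * partialDeriv i f x = 0) (i : Fin n) :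
    ∫ x, natGauss θ x * (x i * f x) = 0 := by
  simp [integral_natGauss_mul_coord_mul hθ hf hint hderiv, hzero, hzero']

theorem integral_natGauss_mul_coord_mul_coord_mul_eq_zero (hθ : θ ∈ gAdmissible n)
    (hf : ExpIntegrableC2 (suff · θ) f) (hzero : ∫ x, natGauss θ x * f x = 0)
    (hzero₁ : ∀ i, ∫ x, natGauss θ x * partialDeriv i f x = 0)
    (hzero₂ : ∀ i j, ∫ x, natGauss θ x * partialDeriv j (partialDeriv i f) x = 0)
    (i j : Fin n) : ∫ x, natGauss θ x * (x i * (x j * f x)) = 0 := by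
  have hdiff : Differentiable ℝ f := hf.contDiff.differentiable two_ne_zero
  have hcoord : Differentiable ℝ fun x : Vec n => x j := by fun_prop
  have hderiv (i : Fin n) : partialDeriv i (fun x => x j * f x) =
      fun x => x j * partialDeriv i f x + (if j = i then 1 else 0) * f x :=
    funext fun x => by rw [partialDeriv_mul (hcoord x) (hdiff x), partialDeriv_coord]
  have hint₁ (i : Fin n) : ExpIntegrable (suff · θ) fun x => x j * partialDeriv i f x :=
    (hf.deriv₁ i).moderateGrowth_mul (moderateGrowth_coord j)
  have hint₂ (i : Fin n) :
      ExpIntegrable (suff · θ) fun x => (if j = i then 1 else 0) * f x := hf.base.const_mul _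
  refine integral_natGauss_mul_coord_mul_eq_zero hθ (hcoord.fun_mul hdiff)
    (hf.base.moderateGrowth_mul (moderateGrowth_coord j)) (fun i => ?_)
    (integral_natGauss_mul_coord_mul_eq_zero hθ hdiff hf.base hf.deriv₁ hzero hzero₁ j)
    (fun i => ?_) i
  · rw [hderiv]
    exact (hint₁ i).add (hint₂ i)
  · simp only [hderiv, mul_add]
    rw [integral_add ((hint₁ i).integrable_natGauss_mul hθ)
      ((hint₂ i).integrable_natGauss_mul hθ),
      integral_natGauss_mul_coord_mul_eq_zero hθ
        ((contDiff_partialDeriv hf.contDiff i).differentiable one_ne_zero) (hf.deriv₁ i)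
        (hf.deriv₂ i) (hzero₁ i) (hzero₂ i)]
    simp only [mul_left_comm (natGauss θ _), integral_const_mul, hzero, mul_zero, add_zero]

theorem integral_natGauss_mul_suff_add_const_mul_eq_zero (hθ : θ ∈ gAdmissible n)
    (hf : ExpIntegrableC2 (suff · θ) f) (hzero : ∫ x, natGauss θ x * f x = 0)
    (hzero₁ : ∀ i, ∫ x, natGauss θ x * partialDeriv i f x = 0)
    (hzero₂ : ∀ i j, ∫ x, natGauss θ x * partialDeriv j (partialDeriv i f) x = 0)
    (v : GParam n) (c : ℝ) : ∫ x, natGauss θ x * ((suff x v + c) * f x) = 0 := by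
  have hlin (i : Fin n) : Integrable fun x => natGauss θ x * (x i * f x) :=
    (hf.base.moderateGrowth_mul (moderateGrowth_coord i)).integrable_natGauss_mul hθ
  have hquad (i j : Fin n) : Integrable fun x => natGauss θ x * (x i * (x j * f x)) :=
    ((hf.base.moderateGrowth_mul (moderateGrowth_coord j)).moderateGrowth_mul
      (moderateGrowth_coord i)).integrable_natGauss_mul hθ
  have hexpand (x : Vec n) : natGauss θ x * ((suff x v + c) * f x) =
      ∑ i, v.gam i * (natGauss θ x * (x i * f x)) +
        ∑ i, ∑ j, v.Gam i j * (natGauss θ x * (x i * (x j * f x))) +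
        c * (natGauss θ x * f x) := by
    simp only [suff_apply, add_mul, mul_add, Finset.sum_mul, Finset.mul_sum]
    congr 1
    · congr 1
      · exact Finset.sum_congr rfl fun i _ => by ring
      · exact Finset.sum_congr rfl fun i _ => Finset.sum_congr rfl fun j _ => by ring
    · ring
  have hlinsum := integrable_finsetSum Finset.univ fun i _ => (hlin i).const_mul (v.gam i)
  have hquadrow (i : Fin n) :=
    integrable_finsetSum Finset.univ fun j _ => (hquad i j).const_mul (v.Gam i j)
  have hquadsum := integrable_finsetSum Finset.univ fun i _ => hquadrow i
  simp only [hexpand]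
  rw [integral_add (hlinsum.fun_add hquadsum) ((hf.base.integrable_natGauss_mul hθ).const_mul c),
    integral_add hlinsum hquadsum, integral_finsetSum _ fun i _ => (hlin i).const_mul _,
    integral_finsetSum _ fun i _ => hquadrow i]
  simp only [integral_finsetSum _ fun j _ => (hquad _ j).const_mul _, integral_const_mul,
    integral_natGauss_mul_coord_mul_coord_mul_eq_zero hθ hf hzero hzero₁ hzero₂,
    integral_natGauss_mul_coord_mul_eq_zero hθ (hf.contDiff.differentiable two_ne_zero) hf.base
      hf.deriv₁ hzero hzero₁, hzero, mul_zero, Finset.sum_const_zero, add_zero]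

end Stein

/-! ### Fisher information as a quadratic form -/

section FisherInfo

variable {Ω ι : Type*} [MeasurableSpace Ω] [Fintype ι] [DecidableEq ι] {ν : Measure Ω}
  {p : (ι → ℝ) → Ω → ℝ} {θ : ι → ℝ}

/-- The score of a parametric family of densities, as a linear functional of the direction in
which the parameter moves. -/
def fisherScore (p : (ι → ℝ) → Ω → ℝ) (θ : ι → ℝ) (y : Ω) : (ι → ℝ) →L[ℝ] ℝ :=
  fderiv ℝ (fun θ' => Real.log (p θ' y)) θ

theorem dotProduct_fisherInfo_mulVec
    (hint : ∀ u v, Integrable (fun y => p θ y * (fisherScore p θ y u * fisherScore p θ y v)) ν)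
    (u v : ι → ℝ) : u ⬝ᵥ (fisherInfo ν p θ *ᵥ v) =
      ∫ y, p θ y * (fisherScore p θ y u * fisherScore p θ y v) ∂ν := by
  let s (a b : ι) (y : Ω) : ℝ :=
    p θ y * (fisherScore p θ y (Pi.single a 1) * fisherScore p θ y (Pi.single b 1))
  have hexpand (y : Ω) : p θ y * (fisherScore p θ y u * fisherScore p θ y v) =
      ∑ a, ∑ b, u a * v b * s a b y := by
    have hlin (w : ι → ℝ) :
        fisherScore p θ y w = ∑ a, w a * fisherScore p θ y (Pi.single a 1) := by
      conv_lhs => rw [pi_eq_sum_univ' w]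
      simp only [map_sum, map_smul, smul_eq_mul]
    rw [hlin u, hlin v, Finset.sum_mul_sum, Finset.mul_sum]
    refine Finset.sum_congr rfl fun a _ => ?_
    rw [Finset.mul_sum]
    exact Finset.sum_congr rfl fun b _ => by simp only [s]; ring
  have hterm (a b : ι) : Integrable (fun y => u a * v b * s a b y) ν := (hint _ _).const_mul _
  simp only [hexpand]
  rw [integral_finsetSum _ fun a _ => integrable_finsetSum _ fun b _ => hterm a b,
    dotProduct_mulVec_eq_sum]
  refine Finset.sum_congr rfl fun a _ => ?_
  rw [integral_finsetSum _ fun b _ => hterm a b]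
  exact Finset.sum_congr rfl fun b _ => (integral_const_mul _ _).symm

theorem posDef_fisherInfo
    (hint : ∀ u v, Integrable (fun y => p θ y * (fisherScore p θ y u * fisherScore p θ y v)) ν)
    (hp : ∀ y, 0 < p θ y) (hscore : ∀ v, (∀ᵐ y ∂ν, fisherScore p θ y v = 0) → v = 0) :
    (fisherInfo ν p θ).PosDef := by
  refine .of_dotProduct_mulVec_pos ?_ fun v hv => ?_
  · ext a b
    simp only [fisherInfo, Matrix.conjTranspose_apply, Matrix.of_apply, star_trivial, mul_comm]
  have hnonneg : 0 ≤ fun y => p θ y * (fisherScore p θ y v * fisherScore p θ y v) :=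
    fun y => mul_nonneg (hp y).le (mul_self_nonneg _)
  rw [star_trivial, dotProduct_fisherInfo_mulVec hint]
  refine (integral_nonneg hnonneg).lt_of_ne' fun hzero => hv (hscore v ?_)
  filter_upwards [(integral_eq_zero_iff_of_nonneg hnonneg (hint v v)).1 hzero] with y hy
  exact mul_self_eq_zero.1 ((mul_eq_zero.1 hy).resolve_left (hp y).ne')

end FisherInfo

section ProdCount

variable {Ω κ : Type*} [MeasurableSpace Ω] {ν : Measure Ω} [SFinite ν] [MeasurableSpace κ]
  [MeasurableSingletonClass κ] {f : Ω × κ → ℝ}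

theorem integrable_prod_count [Finite κ] (hf : AEStronglyMeasurable f (ν.prod .count))
    (hi : ∀ k, Integrable (fun x => f (x, k)) ν) : Integrable f (ν.prod .count) :=
  (integrable_prod_iff' hf).2 ⟨.of_forall hi, .of_finite⟩

theorem integral_prod_count [Fintype κ] (hf : Integrable f (ν.prod .count)) :
    ∫ y, f y ∂ν.prod .count = ∑ k, ∫ x, f (x, k) ∂ν := by
  rw [integral_prod_symm _ hf, integral_count]

end ProdCount

/-! ### The approximated Fisher information matrix -/

section ApproxFIM

variable {n m : ℕ} {η : MParam n m}

theorem fisherScore_natGauss {θ : GParam n} (hθ : θ ∈ gAdmissible n) (x : Vec n) :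
    fisherScore natGauss θ x = (gaussFamily n).score θ x :=
  (hasFDerivAt_log_natGauss hθ x).fderiv

theorem fisherScore_weight (w : Fin m → ℝ) (k : Fin (m + 1)) :
    fisherScore weight w k = wscore w k :=
  (hasFDerivAt_log_weight w k).fderiv

theorem fisherScore_jointQ (hη : η ∈ admissible n m) (x : Vec n) (k : Fin (m + 1)) :
    fisherScore jointQ η (x, k) = (jointFamily n k).score η x :=
  (hasFDerivAt_log_jointQ hη x k).fderiv

theorem ModerateGrowth.integrable_natGauss_mul {θ : GParam n} (hθ : θ ∈ gAdmissible n)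
    {f : Vec n → ℝ} (hf : ModerateGrowth f) : Integrable fun x => natGauss θ x * f x :=
  (hf.expIntegrable (expIntegrable_one hθ)).integrable_natGauss_mul hθ

theorem integrable_natGauss_mul_fisherScore_mul_fisherScore {θ : GParam n}
    (hθ : θ ∈ gAdmissible n) (u v : GParam n) : Integrable fun x =>
      natGauss θ x * (fisherScore natGauss θ x u * fisherScore natGauss θ x v) := by
  simp only [fisherScore_natGauss hθ]
  exact (QuadExpFamily.moderateGrowth_score_apply θ u).mul
    (QuadExpFamily.moderateGrowth_score_apply θ v) |>.integrable_natGauss_mul hθ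

theorem continuous_fisherScore_jointQ (hη : η ∈ admissible n m) :
    Continuous (fisherScore (jointQ (n := n) (m := m)) η) :=
  continuous_prod_of_discrete_right.2 fun k => by
    simp only [fisherScore_jointQ hη]
    exact (jointFamily n k).continuous_score η

theorem continuous_jointQ (hη : η ∈ admissible n m) : Continuous (jointQ η) :=
  continuous_prod_of_discrete_right.2 fun k => by
    simp only [← jointFamily_density hη]
    exact (jointFamily n k).continuous_density η

theorem integrable_jointQ_mul_fisherScore_mul_fisherScore (hη : η ∈ admissible n m)
    (u v : MParam n m) : Integrable (fun y =>
      jointQ η y * (fisherScore jointQ η y u * fisherScore jointQ η y v))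
      ((volume : Measure (Vec n)).prod Measure.count) := by
  have hscore (v : MParam n m) := (continuous_fisherScore_jointQ hη).clm_apply
    (continuous_const (y := v))
  refine integrable_prod_count
    ((continuous_jointQ hη).mul ((hscore u).mul (hscore v))).aestronglyMeasurable fun k => ?_
  simp only [fisherScore_jointQ hη, jointQ, mul_right_comm _ (weight η.odds k)]
  exact (((QuadExpFamily.moderateGrowth_score_apply η u).mul
    (QuadExpFamily.moderateGrowth_score_apply η v)).integrable_natGauss_mul (hη k)).mul_const _

theorem dotProduct_approxFIM_mulVec (hη : η ∈ admissible n m) (u v : MParam n m) :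
    u ⬝ᵥ (approxFIM η *ᵥ v) = ∑ k, weight η.odds k * compE η k fun x =>
      (jointFamily n k).score η x u * (jointFamily n k).score η x v := by
  rw [approxFIM, dotProduct_fisherInfo_mulVec
    (integrable_jointQ_mul_fisherScore_mul_fisherScore hη), integral_prod_count
    (integrable_jointQ_mul_fisherScore_mul_fisherScore hη u v)]
  simp only [integral_jointQ_mul, fisherScore_jointQ hη]

theorem eq_zero_of_gam_eq_zero_of_Gam_eq_zero {θ : GParam n} (hgam : θ.gam = 0)
    (hGam : θ.Gam = 0) : θ = 0 := by
  ext (i | ⟨⟨i, j⟩, hij : i ≤ j⟩)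
  · exact congrFun hgam i
  · simpa [GParam.Gam, hij] using congrFun₂ hGam i j

theorem eq_zero_of_suff_add_const_eq_zero {θ : GParam n} {c : ℝ}
    (h : ∀ x : Vec n, suff x θ + c = 0) : θ = 0 := by
  have hgrad (i : Fin n) : suffGrad θ i = fun _ => 0 := by
    ext x
    rw [← partialDeriv_suff, funext fun x => eq_neg_of_add_eq_zero_left (h x),
      partialDeriv_const]
  refine eq_zero_of_gam_eq_zero_of_Gam_eq_zero (funext fun i => ?_) (Matrix.ext fun i j => ?_)
  · simpa [suffGrad] using congrFun (hgrad i) 0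
  · have hderiv := partialDeriv_suffGrad θ i j 0
    rw [hgrad, partialDeriv_const] at hderiv
    exact (mul_eq_zero.1 hderiv.symm).resolve_left two_ne_zero

theorem eq_zero_of_jointFamily_score_apply_eq_zero (hη : η ∈ admissible n m) {v : MParam n m}
    (h : ∀ x k, (jointFamily n k).score η x v = 0) : v = 0 := by
  simp only [jointFamily_score_apply hη] at h
  have hcomp (k : Fin (m + 1)) : v.comp k = 0 :=
    eq_zero_of_suff_add_const_eq_zero
      (c := wscore η.odds k v.odds - fderiv ℝ logZ (η.comp k) (v.comp k)) fun x => by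
        rw [← h x k, gaussFamily_score_apply]; ring
  have hodds : v.odds = 0 := eq_zero_of_wscore_apply_eq_zero (w := η.odds) fun k => by
    simpa only [hcomp, map_zero, zero_add] using h 0 k
  ext (⟨a, k⟩ | k)
  · exact congrFun (hcomp k) a
  · exact congrFun hodds k

theorem approxFIM_posDef (hη : η ∈ admissible n m) : (approxFIM η).PosDef := by
  have : (Measure.count : Measure (Fin (m + 1))).IsOpenPosMeasure :=
    ⟨fun _ _ hU => Measure.count_ne_zero hU⟩
  refine posDef_fisherInfo (integrable_jointQ_mul_fisherScore_mul_fisherScore hη)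
    (jointQ_pos hη) fun v hv => ?_
  have hzero := ((continuous_fisherScore_jointQ hη).clm_apply continuous_const).ae_eq_iff_eq _
    continuous_const |>.1 hv
  refine eq_zero_of_jointFamily_score_apply_eq_zero hη fun x k => ?_
  rw [← fisherScore_jointQ hη]
  exact congrFun hzero (x, k)

theorem compE_score_mul_score (hη : η ∈ admissible n m) (u v : MParam n m) (k : Fin (m + 1)) :
    (compE η k fun x => (jointFamily n k).score η x u * (jointFamily n k).score η x v) =
      u.comp k ⬝ᵥ (fisherInfo volume natGauss (η.comp k) *ᵥ v.comp k) +
        wscore η.odds k u.odds * wscore η.odds k v.odds := by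
  set g : GParam n → Vec n → ℝ := fun v x => (gaussFamily n).score (η.comp k) x v
  have hg (v : GParam n) : ModerateGrowth (g v) := QuadExpFamily.moderateGrowth_score_apply _ v
  have hscore (c : ℝ) (v : GParam n) : ∫ x, natGauss (η.comp k) x * g v x * c = 0 := by
    rw [integral_mul_const, integral_natGauss_mul_score_apply (hη k), zero_mul]
  rw [dotProduct_fisherInfo_mulVec
    (integrable_natGauss_mul_fisherScore_mul_fisherScore (hη k))]
  have hexpand (x : Vec n) : natGauss (η.comp k) x *
      ((jointFamily n k).score η x u * (jointFamily n k).score η x v) =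
      natGauss (η.comp k) x * (g (u.comp k) x * g (v.comp k) x) +
        natGauss (η.comp k) x * g (u.comp k) x * wscore η.odds k v.odds +
        natGauss (η.comp k) x * g (v.comp k) x * wscore η.odds k u.odds +
        natGauss (η.comp k) x * (wscore η.odds k u.odds * wscore η.odds k v.odds) := by
    rw [jointFamily_score_apply hη, jointFamily_score_apply hη]; ring
  have hint {f : Vec n → ℝ} (hf : ModerateGrowth f) := hf.integrable_natGauss_mul (hη k)
  have hprod := hint ((hg (u.comp k)).mul (hg (v.comp k)))
  have hcross (w : GParam n) (c : ℝ) := (hint (hg w)).mul_const c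
  simp only [compE, hexpand, fisherScore_natGauss (hη k)]
  rw [integral_add ((hprod.fun_add (hcross _ _)).fun_add (hcross _ _)) (hint (.const _)),
    integral_add (hprod.fun_add (hcross _ _)) (hcross _ _), integral_add hprod (hcross _ _),
    hscore, hscore, integral_mul_const, integral_natGauss (hη k), one_mul, add_zero, add_zero]

theorem dotProduct_fisherInfo_weight_mulVec (w u v : Fin m → ℝ) :
    u ⬝ᵥ (fisherInfo .count weight w *ᵥ v) = ∑ k, weight w k * (wscore w k u * wscore w k v) := by
  rw [dotProduct_fisherInfo_mulVec fun _ _ => .of_finite, integral_count]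
  simp only [fisherScore_weight]

theorem comp_single_inl (a : GIndex n) (k j : Fin (m + 1)) :
    MParam.comp (Pi.single (Sum.inl (a, k)) 1 : MParam n m) j =
      if j = k then Pi.single a 1 else 0 := by
  ext b
  by_cases hj : j = k <;> by_cases hb : b = a <;> simp [MParam.comp, hj, hb]

theorem odds_single_inl (a : GIndex n) (k : Fin (m + 1)) :
    MParam.odds (Pi.single (Sum.inl (a, k)) 1 : MParam n m) = 0 := by
  ext b; simp [MParam.odds]

theorem comp_single_inr (i : Fin m) (j : Fin (m + 1)) :
    MParam.comp (Pi.single (Sum.inr i) 1 : MParam n m) j = 0 := by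
  ext b; simp [MParam.comp]

theorem odds_single_inr (i : Fin m) :
    MParam.odds (Pi.single (Sum.inr i) 1 : MParam n m) = Pi.single i 1 := by
  ext b; simp [MParam.odds, Pi.single_apply]

theorem approxFIM_eq_fromBlocks (hη : η ∈ admissible n m) :
    approxFIM η = Matrix.fromBlocks
      (Matrix.blockDiagonal fun k => weight η.odds k • fisherInfo volume natGauss (η.comp k))
      0 0 (fisherInfo .count weight η.odds) := by
  ext a b
  have hentry : approxFIM η a b = Pi.single a 1 ⬝ᵥ (approxFIM η *ᵥ Pi.single b 1) := by
    rw [single_one_dotProduct, Matrix.mulVec_single_one, Matrix.col_apply]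
  rw [hentry, dotProduct_approxFIM_mulVec hη]
  simp only [compE_score_mul_score hη, mul_add, Finset.sum_add_distrib,
    ← dotProduct_fisherInfo_weight_mulVec]
  rcases a with ⟨a, k⟩ | i <;> rcases b with ⟨b, l⟩ | j
  · rw [Finset.sum_eq_single k (fun r _ hr => by simp [comp_single_inl, hr]) (by simp)]
    rcases eq_or_ne k l with rfl | hkl
    · simp [comp_single_inl, odds_single_inl]
    · simp [comp_single_inl, odds_single_inl, hkl, Matrix.blockDiagonal_apply_ne]
  · simp [comp_single_inr, odds_single_inl]
  · simp [comp_single_inr, odds_single_inl]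
  · simp [comp_single_inr, odds_single_inr]

end ApproxFIM

/-! ### The relative entropy of a mixture -/

section Objective

variable {n m : ℕ} {η : MParam n m} {g p : Vec n → ℝ}

theorem mixture_pos (hη : η ∈ admissible n m) (x : Vec n) : 0 < mixture η x :=
  Finset.sum_pos (fun k _ => jointQ_pos hη (x, k)) Finset.univ_nonempty

theorem log_mixture (hη : η ∈ admissible n m) (x : Vec n) :
    Real.log (mixture η x) = logSumExp fun k => (jointFamily n k).logDensity η x := by
  simp only [logSumExp, mixture, ← jointFamily_density hη, QuadExpFamily.density]

/-- The posterior probability `q(ω = k | x; η)` of the component label. -/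
def responsibility (η : MParam n m) (x : Vec n) (k : Fin (m + 1)) : ℝ :=
  softmax (fun j => (jointFamily n j).logDensity η x) k

/-- The derivative of `log q(x; η)` in the parameters: the scores of the components averaged with
their responsibilities. -/
def mixtureScore (η : MParam n m) (x : Vec n) : MParam n m →L[ℝ] ℝ :=
  ∑ k, responsibility η x k • (jointFamily n k).score η x

theorem mixture_mul_responsibility (hη : η ∈ admissible n m) (x : Vec n) (k : Fin (m + 1)) :
    mixture η x * responsibility η x k = jointQ η (x, k) := by
  rw [responsibility, softmax, ← log_mixture hη, Real.exp_sub, ← log_jointQ hη,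
    Real.exp_log (jointQ_pos hη _), Real.exp_log (mixture_pos hη x),
    mul_div_cancel₀ _ (mixture_pos hη x).ne']

theorem mixture_mul_mixtureScore_apply (hη : η ∈ admissible n m) (x : Vec n) (v : MParam n m) :
    mixture η x * mixtureScore η x v =
      ∑ k, jointQ η (x, k) * (jointFamily n k).score η x v := by
  simp [mixtureScore, Finset.mul_sum, ← mul_assoc, mixture_mul_responsibility hη]

theorem hasFDerivAt_log_mixture (hη : η ∈ admissible n m) (x : Vec n) :
    HasFDerivAt (fun η => Real.log (mixture η x)) (mixtureScore η x) η := by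
  have hlog : HasFDerivAt (fun η k => (jointFamily n k).logDensity η x)
      (ContinuousLinearMap.pi fun k => (jointFamily n k).score η x) η :=
    hasFDerivAt_pi.2 fun k => QuadExpFamily.hasFDerivAt_logDensity
      ((contDiffAt_jointFamily_logPartition hη k).differentiableAt one_ne_zero) x
  refine (((hasFDerivAt_logSumExp _).comp η hlog).congr_of_eventuallyEq ?_).congr_fderiv ?_
  · filter_upwards [isOpen_admissible.mem_nhds hη] with η' hη'
    exact log_mixture hη' x
  · ext v
    simp [mixtureScore, responsibility]

theorem moderateGrowthC2_log_mixture (hη : η ∈ admissible n m) :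
    ModerateGrowthC2 fun x => Real.log (mixture η x) := by
  have hlogDensity (k : Fin (m + 1)) :
      ModerateGrowthC2 fun x => (jointFamily n k).logDensity η x := by
    simp only [QuadExpFamily.logDensity, jointFamily_stat_apply, add_sub_assoc]
    exact moderateGrowthC2_suff_add_const _ _
  simpa only [log_mixture hη] using moderateGrowthC2_logSumExp hlogDensity

theorem moderateGrowth_responsibility (η : MParam n m) (k : Fin (m + 1)) :
    ModerateGrowth fun x => responsibility η x k :=
  moderateGrowth_softmax (fun j => (jointFamily n j).continuous_logDensity η) k

theorem continuous_mixtureScore (η : MParam n m) : Continuous (mixtureScore η) :=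
  continuous_finsetSum _ fun k _ =>
    (moderateGrowth_responsibility η k).continuous.smul ((jointFamily n k).continuous_score η)

theorem moderateGrowth_mixtureScore_apply (η v : MParam n m) :
    ModerateGrowth fun x => mixtureScore η x v := by
  have happly (x : Vec n) : mixtureScore η x v =
      ∑ k, responsibility η x k * (jointFamily n k).score η x v := by simp [mixtureScore]
  simp only [happly]
  exact .sum _ fun k _ => (moderateGrowth_responsibility η k).mul
    (QuadExpFamily.moderateGrowth_score_apply η v)

theorem eventually_log_mixture_mixtureScore_le (hη : η ∈ admissible n m) :
    ∃ C, ∀ᶠ η' in 𝓝 η, ∀ x : Vec n, |Real.log (mixture η' x)| ≤ C * (1 + ‖x‖ ^ 2) ∧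
      ‖mixtureScore η' x‖ ≤ C * (1 + ‖x‖ ^ 2) := by
  have hZ := contDiffAt_jointFamily_logPartition hη
  choose A hA using fun k => QuadExpFamily.eventually_abs_logDensity_le (hZ k).continuousAt
  choose B hB using fun k =>
    QuadExpFamily.eventually_norm_score_le ((hZ k).continuousAt_fderiv one_ne_zero)
  obtain ⟨C, hC⟩ := Finite.bddAbove_range fun k => max (A k) (B k)
  have hle (k : Fin (m + 1)) : A k ≤ C ∧ B k ≤ C := max_le_iff.1 (hC (Set.mem_range_self k))
  have hlog : 0 ≤ Real.log (Fintype.card (Fin (m + 1))) := Real.log_natCast_nonneg _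
  refine ⟨C + Real.log (Fintype.card (Fin (m + 1))), ?_⟩
  filter_upwards [isOpen_admissible.mem_nhds hη, Filter.eventually_all.2 hA,
    Filter.eventually_all.2 hB] with η' hη' hA hB x
  rw [log_mixture hη', add_mul]
  constructor
  · refine (abs_logSumExp_le fun k => (hA k x).trans ?_).trans
      (add_le_add_right (le_mul_of_one_le_right hlog ?_) _)
    · gcongr; exact (hle k).1
    · exact le_add_of_nonneg_right (by positivity)
  · refine (norm_sum_softmax_smul_le fun k => (hB k x).trans ?_).trans
      (le_add_of_nonneg_right (by positivity))
    gcongr; exact (hle k).2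

theorem dominatedAt_log_mixture_sub (hη : η ∈ admissible n m) {k : Fin (m + 1)}
    (hgc : Continuous g) (hg : ExpIntegrable (suff · (η.comp k)) g) :
    (jointFamily n k).DominatedAt (fun η x => Real.log (mixture η x) - g x) mixtureScore η := by
  obtain ⟨C, hC⟩ := eventually_log_mixture_mixtureScore_le hη
  have hgrowth : ModerateGrowth fun x : Vec n => C * (1 + ‖x‖ ^ 2) :=
    (ModerateGrowth.const C).mul .one_add_norm_sq
  have hadm := isOpen_admissible.mem_nhds hη
  refine ⟨?_, continuous_mixtureScore η, fun x => C * (1 + ‖x‖ ^ 2) + |g x|,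
    (expIntegrable_jointFamily_stat_iff k).2
      ((hgrowth.expIntegrable (expIntegrable_one (hη k))).add hg.norm), ?_⟩
  · filter_upwards [hadm] with η' hη'
    exact (moderateGrowthC2_log_mixture hη').base.continuous.sub hgc
  · filter_upwards [hadm, hC] with η' hη' hC x
    exact ⟨(hasFDerivAt_log_mixture hη' x).sub_const _,
      (norm_sub_le _ _).trans (add_le_add_left (hC x).1 _),
      (hC x).2.trans (le_add_of_nonneg_right (abs_nonneg _))⟩

theorem ExpIntegrable.integrable_jointQ_mul (hη : η ∈ admissible n m) {k : Fin (m + 1)}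
    (hg : ExpIntegrable (suff · (η.comp k)) g) : Integrable fun x => jointQ η (x, k) * g x := by
  simp only [jointQ, mul_right_comm]
  exact (hg.integrable_natGauss_mul (hη k)).mul_const _

theorem sum_integral_jointQ_mul_score_apply (hη : η ∈ admissible n m) (v : MParam n m) :
    ∑ k, ∫ x, jointQ η (x, k) * (jointFamily n k).score η x v = 0 := by
  rw [← sum_weight_mul_wscore_apply η.odds v.odds]
  refine Finset.sum_congr rfl fun k _ => ?_
  have hgauss : Integrable fun x => natGauss (η.comp k) x *
      (gaussFamily n).score (η.comp k) x (v.comp k) :=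
    (QuadExpFamily.moderateGrowth_score_apply _ _).integrable_natGauss_mul (hη k)
  rw [integral_jointQ_mul, compE]
  simp only [jointFamily_score_apply hη, mul_add]
  rw [integral_add hgauss ((ModerateGrowth.const _).integrable_natGauss_mul (hη k)),
    integral_natGauss_mul_score_apply (hη k), integral_mul_const, integral_natGauss (hη k),
    one_mul, zero_add]

theorem sum_integral_jointQ_mul_mixtureScore_apply (hη : η ∈ admissible n m) (v : MParam n m) :
    ∑ k, ∫ x, jointQ η (x, k) * mixtureScore η x v = 0 := by
  have hint {k : Fin (m + 1)} {f : Vec n → ℝ} (hf : ModerateGrowth f) :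
      Integrable fun x => jointQ η (x, k) * f x :=
    (hf.expIntegrable (expIntegrable_one (hη k))).integrable_jointQ_mul hη
  rw [← integral_finsetSum _ fun k _ => hint (moderateGrowth_mixtureScore_apply η v),
    ← sum_integral_jointQ_mul_score_apply hη v,
    ← integral_finsetSum _ fun k _ => hint (QuadExpFamily.moderateGrowth_score_apply η v)]
  simp only [← Finset.sum_mul, ← mixture_mul_mixtureScore_apply hη]
  rfl

theorem klIntegrand_mixture (hη : η ∈ admissible n m) (hp : ∀ x, 0 < p x) (x : Vec n) :
    klIntegrand (mixture η) p x =
      ∑ k, jointQ η (x, k) * (Real.log (mixture η x) - Real.log (p x)) := by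
  rw [klIntegrand, Real.log_div (mixture_pos hη x).ne' (hp x).ne', ← Finset.sum_mul]
  rfl

theorem eventually_integrable_jointQ_mul_log (hη : η ∈ admissible n m) (hgc : Continuous g)
    (hg : ∀ k, ExpIntegrable (suff · (η.comp k)) g) : ∀ᶠ η' in 𝓝 η, ∀ k, Integrable fun x =>
      jointQ η' (x, k) * (Real.log (mixture η' x) - g x) := by
  refine Filter.eventually_all.2 fun k => ?_
  filter_upwards [isOpen_admissible.mem_nhds hη, (dominatedAt_log_mixture_sub hη hgc
    (hg k)).eventually_integrable (contDiffAt_jointFamily_logPartition hη k)] with η' hη' hint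
  simpa only [jointFamily_density hη'] using hint

theorem integrable_klIntegrand_mixture (hη : η ∈ admissible n m) (hp : ∀ x, 0 < p x)
    (hpc : Continuous fun x => Real.log (p x))
    (hlog : ∀ k, ExpIntegrable (suff · (η.comp k)) fun x => Real.log (p x)) :
    Integrable (klIntegrand (mixture η) p) := by
  have hint := (eventually_integrable_jointQ_mul_log hη hpc hlog).self_of_nhds
  exact (integrable_finsetSum _ fun k _ => hint k).congr
    (.of_forall fun x => (klIntegrand_mixture hη hp x).symm)

theorem kl_mixture_eventuallyEq (hη : η ∈ admissible n m) (hp : ∀ x, 0 < p x)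
    (hpc : Continuous fun x => Real.log (p x))
    (hlog : ∀ k, ExpIntegrable (suff · (η.comp k)) fun x => Real.log (p x)) :
    (fun η => kl (mixture η) p) =ᶠ[𝓝 η] fun η => ∑ k, ∫ x,
      (jointFamily n k).density η x * (Real.log (mixture η x) - Real.log (p x)) := by
  filter_upwards [isOpen_admissible.mem_nhds hη,
    eventually_integrable_jointQ_mul_log hη hpc hlog] with η' hη' hint
  simp only [kl, klIntegrand_mixture hη' hp, jointFamily_density hη']
  exact integral_finsetSum _ fun k _ => hint k

theorem differentiableAt_kl_mixture (hη : η ∈ admissible n m) (hp : ∀ x, 0 < p x)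
    (hpc : Continuous fun x => Real.log (p x))
    (hlog : ∀ k, ExpIntegrable (suff · (η.comp k)) fun x => Real.log (p x)) :
    DifferentiableAt ℝ (fun η => kl (mixture η) p) η := by
  refine (kl_mixture_eventuallyEq hη hp hpc hlog).differentiableAt_iff.2 ?_
  exact .fun_sum fun k _ => ((dominatedAt_log_mixture_sub hη hpc (hlog k)).hasFDerivAt_integral
    (contDiffAt_jointFamily_logPartition hη k)).differentiableAt

theorem fderiv_kl_mixture_apply (hη : η ∈ admissible n m) (hp : ∀ x, 0 < p x)
    (hpc : Continuous fun x => Real.log (p x))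
    (hlog : ∀ k, ExpIntegrable (suff · (η.comp k)) fun x => Real.log (p x)) (v : MParam n m) :
    fderiv ℝ (fun η => kl (mixture η) p) η v = ∑ k, weight η.odds k * compE η k fun x =>
      (jointFamily n k).score η x v * (Real.log (mixture η x) - Real.log (p x)) := by
  have hdom (k : Fin (m + 1)) := dominatedAt_log_mixture_sub hη hpc (hlog k)
  have hZ := contDiffAt_jointFamily_logPartition hη
  have hone (k : Fin (m + 1)) := expIntegrable_one (hη k)
  have hmix := moderateGrowth_mixtureScore_apply η v
  have hV (k : Fin (m + 1)) : ExpIntegrable (suff · (η.comp k))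
      fun x => Real.log (mixture η x) - Real.log (p x) :=
    ((moderateGrowthC2_log_mixture hη).base.expIntegrable (hone k)).sub (hlog k)
  have hsplit (k : Fin (m + 1)) := integral_add
    (((hV k).moderateGrowth_mul (QuadExpFamily.moderateGrowth_score_apply η v
      (F := jointFamily n k))).integrable_jointQ_mul hη)
    ((hmix.expIntegrable (hone k)).integrable_jointQ_mul hη)
  rw [(kl_mixture_eventuallyEq hη hp hpc hlog).fderiv_eq,
    fderiv_fun_sum fun k _ => ((hdom k).hasFDerivAt_integral (hZ k)).differentiableAt]
  simp only [sum_apply, (hdom _).fderiv_integral_apply (hZ _), jointFamily_density hη,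
    mul_comm (_ - _) (QuadExpFamily.score _ _ _ v), mul_add, hsplit, ← integral_jointQ_mul,
    Finset.sum_add_distrib, sum_integral_jointQ_mul_mixtureScore_apply hη, add_zero]

end Objective

/-! ### The Bayesian model -/

section Model

theorem integral_pos_of_forall_pos {X : Type*} [MeasurableSpace X] {μ : Measure X} [NeZero μ]
    {f : X → ℝ} (hf : ∀ x, 0 < f x) (hint : Integrable f μ) : 0 < ∫ x, f x ∂μ := by
  have hsupp : Function.support f = Set.univ := Set.eq_univ_of_forall fun x => (hf x).ne'
  rw [integral_pos_iff_support_of_nonneg (fun x => (hf x).le) hint, hsupp]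
  exact NeZero.pos _

variable {n m d : ℕ} {η : MParam n m} {prior : Vec n → ℝ} {lik : Vec d → Vec n → ℝ} {z : Vec d}

theorem exists_mem_comp_eq_add_smul_idShift {Θ : Set (MParam n m)} (hΘ : IsOpen Θ)
    (hη : η ∈ Θ) : ∃ ε > (0 : ℝ), ∃ η' ∈ Θ, ∀ k, η'.comp k = η.comp k + ε • idShift n := by
  let shift : MParam n m := Sum.elim (fun p => idShift n p.1) 0
  have hcont : Continuous fun ε : ℝ => η + ε • shift := by fun_prop
  have hnhds : ∀ᶠ ε in 𝓝[>] (0 : ℝ), η + ε • shift ∈ Θ :=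
    ((hcont.tendsto' 0 η (by simp)).eventually (hΘ.mem_nhds hη)).filter_mono nhdsWithin_le_nhds
  obtain ⟨ε, hmem, hε⟩ := (hnhds.and self_mem_nhdsWithin).exists
  exact ⟨ε, hε, _, hmem, fun k => rfl⟩

theorem expIntegrableC2_of_compIntegrable {Θ : Set (MParam n m)} (hΘ : IsOpen Θ)
    (hadm : Θ ⊆ admissible n m) {f : Vec n → ℝ} (hf : ContDiff ℝ 2 f)
    (h : ∀ η ∈ Θ, ∀ k, CompIntegrable η k f ∧ (∀ i, CompIntegrable η k fun x => gradient f x i) ∧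
      ∀ i j, CompIntegrable η k fun x => hessian f x i j) (hη : η ∈ Θ) (k : Fin (m + 1)) :
    ExpIntegrableC2 (suff · (η.comp k)) f := by
  obtain ⟨ε, hε, η', hη', hshift⟩ := exists_mem_comp_eq_add_smul_idShift hΘ hη
  simp only [gradient_apply, hessian_apply hf, CompIntegrable] at h
  have hadm' := hadm hη' k
  have hint := h η' hη' k
  rw [hshift] at hadm' hint
  exact ⟨hf, expIntegrable_of_idShift hε hadm' hint.1,
    fun i => expIntegrable_of_idShift hε hadm' (hint.2.1 i),
    fun i j => expIntegrable_of_idShift hε hadm' (hint.2.2 i j)⟩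

theorem compIntegrable_of_expIntegrableC2 (hη : η ∈ admissible n m) {k : Fin (m + 1)}
    {f : Vec n → ℝ} (hf : ExpIntegrableC2 (suff · (η.comp k)) f) :
    CompIntegrable η k f ∧ (∀ i, CompIntegrable η k fun x => gradient f x i) ∧
      ∀ i j, CompIntegrable η k fun x => hessian f x i j := by
  simp only [gradient_apply, hessian_apply hf.contDiff]
  exact ⟨hf.base.integrable_natGauss_mul (hη k),
    fun i => (hf.deriv₁ i).integrable_natGauss_mul (hη k),
    fun i j => (hf.deriv₂ i j).integrable_natGauss_mul (hη k)⟩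

theorem expIntegrableC2_kernelV (hη : η ∈ admissible n m) {k : Fin (m + 1)}
    (hlog : ExpIntegrableC2 (suff · (η.comp k)) fun x => Real.log (jointP prior lik z x)) :
    ExpIntegrableC2 (suff · (η.comp k)) (kernelV prior lik z η) :=
  ((moderateGrowthC2_log_mixture hη).expIntegrableC2 (expIntegrable_one (hη k))).sub hlog

theorem posterior_pos (hp : ∀ x, 0 < jointP prior lik z x)
    (hint : Integrable (jointP prior lik z)) (x : Vec n) : 0 < posterior prior lik z x :=
  div_pos (hp x) (integral_pos_of_forall_pos hp hint)

theorem log_posterior (hp : ∀ x, 0 < jointP prior lik z x)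
    (hint : Integrable (jointP prior lik z)) (x : Vec n) : Real.log (posterior prior lik z x) =
      Real.log (jointP prior lik z x) - Real.log (∫ y, jointP prior lik z y) :=
  Real.log_div (hp x).ne' (integral_pos_of_forall_pos hp hint).ne'

theorem continuous_log_posterior (hp : ∀ x, 0 < jointP prior lik z x)
    (hint : Integrable (jointP prior lik z))
    (hcont : Continuous fun x => Real.log (jointP prior lik z x)) :
    Continuous fun x => Real.log (posterior prior lik z x) := by
  simp only [log_posterior hp hint]
  exact hcont.sub continuous_const

theorem expIntegrable_log_posterior {u : Vec n → ℝ} (hu : ExpIntegrable u fun _ => 1)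
    (hp : ∀ x, 0 < jointP prior lik z x) (hint : Integrable (jointP prior lik z))
    (hlog : ExpIntegrable u fun x => Real.log (jointP prior lik z x)) :
    ExpIntegrable u fun x => Real.log (posterior prior lik z x) := by
  simp only [log_posterior hp hint]
  exact hlog.sub ((ModerateGrowth.const _).expIntegrable hu)

theorem integrable_klIntegrand_posterior (hη : η ∈ admissible n m)
    (hp : ∀ x, 0 < jointP prior lik z x) (hint : Integrable (jointP prior lik z))
    (hcont : Continuous fun x => Real.log (jointP prior lik z x))
    (hlog : ∀ k, ExpIntegrable (suff · (η.comp k)) fun x => Real.log (jointP prior lik z x)) :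
    Integrable (klIntegrand (mixture η) (posterior prior lik z)) :=
  integrable_klIntegrand_mixture hη (posterior_pos hp hint)
    (continuous_log_posterior hp hint hcont)
    fun k => expIntegrable_log_posterior (expIntegrable_one (hη k)) hp hint (hlog k)

theorem differentiableAt_objective (hη : η ∈ admissible n m)
    (hp : ∀ x, 0 < jointP prior lik z x) (hint : Integrable (jointP prior lik z))
    (hcont : Continuous fun x => Real.log (jointP prior lik z x))
    (hlog : ∀ k, ExpIntegrable (suff · (η.comp k)) fun x => Real.log (jointP prior lik z x)) :
    DifferentiableAt ℝ (objective prior lik z) η :=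
  differentiableAt_kl_mixture hη (posterior_pos hp hint)
    (continuous_log_posterior hp hint hcont)
    fun k => expIntegrable_log_posterior (expIntegrable_one (hη k)) hp hint (hlog k)

theorem fderiv_objective_apply (hη : η ∈ admissible n m)
    (hp : ∀ x, 0 < jointP prior lik z x) (hint : Integrable (jointP prior lik z))
    (hcont : Continuous fun x => Real.log (jointP prior lik z x))
    (hlog : ∀ k, ExpIntegrable (suff · (η.comp k)) fun x => Real.log (jointP prior lik z x))
    (v : MParam n m) : fderiv ℝ (objective prior lik z) η v = ∑ k, weight η.odds k *
      compE η k fun x => (jointFamily n k).score η x v * kernelV prior lik z η x := by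
  have hscore (k : Fin (m + 1)) := QuadExpFamily.moderateGrowth_score_apply (F := jointFamily n k)
    η v
  have hV (k : Fin (m + 1)) : ExpIntegrable (suff · (η.comp k)) (kernelV prior lik z η) :=
    ((moderateGrowthC2_log_mixture hη).base.expIntegrable (expIntegrable_one (hη k))).sub (hlog k)
  have hshift (x : Vec n) : Real.log (mixture η x) - Real.log (posterior prior lik z x) =
      kernelV prior lik z η x + Real.log (∫ y, jointP prior lik z y) := by
    rw [log_posterior hp hint, kernelV, ← sub_add]
  have hsplit (k : Fin (m + 1)) := integral_add
    (((hV k).moderateGrowth_mul (hscore k)).integrable_jointQ_mul hη)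
    ((((hscore k).expIntegrable (expIntegrable_one (hη k))).integrable_jointQ_mul hη).mul_const
      (Real.log (∫ y, jointP prior lik z y)))
  refine (fderiv_kl_mixture_apply hη (posterior_pos hp hint)
    (continuous_log_posterior hp hint hcont)
    (fun k => expIntegrable_log_posterior (expIntegrable_one (hη k)) hp hint (hlog k)) v).trans ?_
  simp only [← integral_jointQ_mul, hshift, mul_add, ← mul_assoc] at hsplit ⊢
  simp only [hsplit, Finset.sum_add_distrib, integral_mul_const, ← Finset.sum_mul,
    sum_integral_jointQ_mul_score_apply hη, zero_mul, add_zero]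

end Model

/-! ### Gaussian projection onto quadratic polynomials -/

section QuadProjection

variable {n : ℕ} {θ : GParam n} {f : Vec n → ℝ}

/-- The quadratic part of the orthogonal projection of `f` onto the quadratic polynomials in `L²`
of the Gaussian with natural parameters `θ`, encoded as the coefficients of `suff x`: by Stein's
identity, it is determined by the means of the gradient and of the Hessian of `f`. The mean of the
Gaussian is `-½ Γ⁻¹ γ`, which is where the correction `½ ∇²f Γ⁻¹ γ` to the gradient comes from. -/
def quadProjection (θ : GParam n) (f : Vec n → ℝ) : GParam n :=
  Sum.elim
    (fun i => ∫ x, natGauss θ x *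
      (((1 / 2 : ℝ) • (hessian f x *ᵥ (θ.Gam⁻¹ *ᵥ θ.gam))) i + gradient f x i))
    fun p => 1 / 2 * ∫ x, natGauss θ x * hessian f x p.1.1 p.1.2

theorem quadProjection_Gam (θ : GParam n) (hf : ContDiff ℝ 2 f) (i j : Fin n) :
    (quadProjection θ f).Gam i j = 1 / 2 * ∫ x, natGauss θ x * hessian f x i j := by
  rcases le_total i j with hij | hij
  · simp [GParam.Gam, quadProjection, hij]
  · simp [GParam.Gam, quadProjection, hij, hessian_apply hf, partialDeriv_comm hf _ j i]

theorem quadProjection_gam (hθ : θ ∈ gAdmissible n) (hf : ExpIntegrableC2 (suff · θ) f)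
    (i : Fin n) : (quadProjection θ f).gam i =
      (∫ x, natGauss θ x * partialDeriv i f x) - 2 * ((quadProjection θ f).Gam *ᵥ θ.mean) i := by
  have hhess (j : Fin n) : Integrable fun x => natGauss θ x * hessian f x i j := by
    simpa only [hessian_apply hf.contDiff] using (hf.deriv₂ i j).integrable_natGauss_mul hθ
  have hexpand (x : Vec n) : natGauss θ x *
      (((1 / 2 : ℝ) • (hessian f x *ᵥ (θ.Gam⁻¹ *ᵥ θ.gam))) i + gradient f x i) =
      natGauss θ x * partialDeriv i f x +
        ∑ j, natGauss θ x * hessian f x i j * (1 / 2 * (θ.Gam⁻¹ *ᵥ θ.gam) j) := by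
    rw [gradient_apply, mul_add, add_comm, Pi.smul_apply, smul_eq_mul, Matrix.mulVec, dotProduct,
      Finset.mul_sum, Finset.mul_sum]
    congr 1
    exact Finset.sum_congr rfl fun j _ => by ring
  change ∫ x, natGauss θ x * _ = _
  simp only [hexpand]
  rw [integral_add ((hf.deriv₁ i).integrable_natGauss_mul hθ)
    (integrable_finsetSum _ fun j _ => (hhess j).mul_const _),
    integral_finsetSum _ fun j _ => (hhess j).mul_const _, sub_eq_add_neg,
    Matrix.mulVec, dotProduct, Finset.mul_sum, ← Finset.sum_neg_distrib]
  congr 1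
  refine Finset.sum_congr rfl fun j _ => ?_
  rw [integral_mul_const, quadProjection_Gam θ hf.contDiff, mean_eq_inv_Gam_mulVec_gam hθ,
    Pi.smul_apply, smul_eq_mul]
  ring

theorem integral_natGauss_mul_suff_add_const_mul_quadProjection_sub (hθ : θ ∈ gAdmissible n)
    (hf : ExpIntegrableC2 (suff · θ) f) {b : ℝ}
    (hmean : ∫ x, natGauss θ x * (suff x (quadProjection θ f) + b - f x) = 0)
    (v : GParam n) (a : ℝ) :
    ∫ x, natGauss θ x * ((suff x v + a) * (suff x (quadProjection θ f) + b - f x)) = 0 := by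
  set w := quadProjection θ f with hw
  have hw₁ (i : Fin n) : partialDeriv i (fun x : Vec n => suff x w + b) = suffGrad w i := by
    rw [← partialDeriv_suff]
    exact funext fun x => by simp only [partialDeriv, fderiv_add_const]
  have hquad : ExpIntegrableC2 (suff · θ) fun x : Vec n => suff x w + b :=
    (moderateGrowthC2_suff_add_const w b).expIntegrableC2 (expIntegrable_one hθ)
  have hquad₁ (i : Fin n) := (moderateGrowth_suffGrad w i).integrable_natGauss_mul hθ
  have hres₁ (i : Fin n) : partialDeriv i (fun x => suff x w + b - f x) =
      fun x => suffGrad w i x - partialDeriv i f x := by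
    rw [← hw₁]
    exact funext fun x => partialDeriv_sub (hquad.contDiff.differentiable two_ne_zero x)
      (hf.contDiff.differentiable two_ne_zero x) i
  refine integral_natGauss_mul_suff_add_const_mul_eq_zero hθ (hquad.sub hf) hmean (fun i => ?_)
    (fun i j => ?_) v a
  · simp only [hres₁, mul_sub]
    rw [integral_sub (hquad₁ i) ((hf.deriv₁ i).integrable_natGauss_mul hθ),
      integral_natGauss_mul_suffGrad hθ, hw, quadProjection_gam hθ hf, sub_add_cancel, sub_self]
  · have hres₂ (x : Vec n) : partialDeriv j (fun x => suffGrad w i x - partialDeriv i f x) x =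
        2 * w.Gam i j - hessian f x i j := by
      rw [partialDeriv_sub, partialDeriv_suffGrad, hessian_apply hf.contDiff]
      · rw [← hw₁]
        exact (contDiff_partialDeriv hquad.contDiff i).differentiable one_ne_zero x
      · exact (contDiff_partialDeriv hf.contDiff i).differentiable one_ne_zero x
    have hhess : Integrable fun x => natGauss θ x * hessian f x i j := by
      simpa only [hessian_apply hf.contDiff] using (hf.deriv₂ i j).integrable_natGauss_mul hθ
    simp only [hres₁, hres₂, mul_sub]
    rw [integral_sub ((integrable_natGauss hθ).mul_const _) hhess, integral_mul_const,
      integral_natGauss hθ, hw, quadProjection_Gam θ hf.contDiff]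
    ring

theorem integral_natGauss_mul_score_add_integral_sub (hθ : θ ∈ gAdmissible n)
    (hf : ExpIntegrable (suff · θ) f) (w : GParam n) :
    ∫ x, natGauss θ x *
      ((gaussFamily n).score θ x w + (∫ y, natGauss θ y * f y) - f x) = 0 := by
  have hscore := (QuadExpFamily.moderateGrowth_score_apply (F := gaussFamily n) θ
    w).integrable_natGauss_mul hθ
  have hconst := (integrable_natGauss hθ).mul_const (∫ y, natGauss θ y * f y)
  simp only [mul_sub, mul_add]
  rw [integral_sub (hscore.fun_add hconst) (hf.integrable_natGauss_mul hθ),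
    integral_add hscore hconst, integral_natGauss_mul_score_apply hθ, integral_mul_const,
    integral_natGauss hθ, one_mul, zero_add, sub_self]

theorem integral_natGauss_mul_score_add_const_mul_score_quadProjection_sub
    (hθ : θ ∈ gAdmissible n) (hf : ExpIntegrableC2 (suff · θ) f) (v : GParam n) (a : ℝ) :
    ∫ x, natGauss θ x * (((gaussFamily n).score θ x v + a) *
      ((gaussFamily n).score θ x (quadProjection θ f) + (∫ y, natGauss θ y * f y) - f x)) = 0 := by
  have hmean := integral_natGauss_mul_score_add_integral_sub hθ hf.base (quadProjection θ f)
  simp only [gaussFamily_score_apply, sub_add] at hmean ⊢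
  simp only [sub_eq_add_neg (suff _ _)] at hmean ⊢
  exact integral_natGauss_mul_suff_add_const_mul_quadProjection_sub hθ hf hmean _ _

end QuadProjection

/-! ### The natural gradient -/

section NaturalGradient

variable {n m : ℕ} {η : MParam n m} {V : Vec n → ℝ}

/-- The natural gradient, with respect to the approximated Fisher information, of an objective
whose derivative in a direction `v` is the mean of `V` times the joint score in the direction
`v`. -/
def naturalGradient (V : Vec n → ℝ) (η : MParam n m) : MParam n m :=
  Sum.elim (fun p => quadProjection (η.comp p.2) V p.1)
    fun k => compE η k.castSucc V - compE η (Fin.last m) V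

theorem naturalGradient_comp (V : Vec n → ℝ) (η : MParam n m) (k : Fin (m + 1)) :
    (naturalGradient V η).comp k = quadProjection (η.comp k) V :=
  rfl

theorem logOdds_naturalGradient_odds (V : Vec n → ℝ) (η : MParam n m) (k : Fin (m + 1)) :
    logOdds (naturalGradient V η).odds k = compE η k V - compE η (Fin.last m) V := by
  refine Fin.lastCases ?_ (fun i => ?_) k
  · simp [logOdds]
  · simp [logOdds, MParam.odds, naturalGradient]

theorem wscore_naturalGradient_odds (V : Vec n → ℝ) (η : MParam n m) (k : Fin (m + 1)) :
    wscore η.odds k (naturalGradient V η).odds =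
      compE η k V - ∑ j, weight η.odds j * compE η j V := by
  simp [wscore, logOddsL_apply, logOdds_naturalGradient_odds, mul_sub, Finset.sum_sub_distrib,
    ← Finset.sum_mul, sum_weight]

/-- The constant subtracted from `V` is the same for all components, so it drops out of the mean
over the mixture, under which the score has mean zero. -/
theorem compE_score_mul_score_naturalGradient_sub (hη : η ∈ admissible n m) {k : Fin (m + 1)}
    (hV : ExpIntegrableC2 (suff · (η.comp k)) V) (u : MParam n m) :
    compE η k (fun x => (jointFamily n k).score η x u *
      ((jointFamily n k).score η x (naturalGradient V η) +
        (∑ j, weight η.odds j * compE η j V) - V x)) = 0 := by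
  simpa only [compE, jointFamily_score_apply hη, wscore_naturalGradient_odds,
    naturalGradient_comp, add_assoc, sub_add_cancel] using
    integral_natGauss_mul_score_add_const_mul_score_quadProjection_sub (hη k) hV (u.comp k)
      (wscore η.odds k u.odds)

theorem dotProduct_approxFIM_mulVec_naturalGradient (hη : η ∈ admissible n m)
    (hV : ∀ k, ExpIntegrableC2 (suff · (η.comp k)) V) (u : MParam n m) :
    u ⬝ᵥ (approxFIM η *ᵥ naturalGradient V η) =
      ∑ k, weight η.odds k * compE η k fun x => (jointFamily n k).score η x u * V x := by
  obtain ⟨c, hc⟩ : ∃ c, ∀ k, compE η k (fun x => (jointFamily n k).score η x u *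
      ((jointFamily n k).score η x (naturalGradient V η) + c - V x)) = 0 :=
    ⟨_, fun k => compE_score_mul_score_naturalGradient_sub hη (hV k) u⟩
  have hscore (k : Fin (m + 1)) (v : MParam n m) :
      ModerateGrowth fun x => (jointFamily n k).score η x v :=
    QuadExpFamily.moderateGrowth_score_apply η v
  have hsplit (k : Fin (m + 1)) :
      compE η k (fun x =>
        (jointFamily n k).score η x u * (jointFamily n k).score η x (naturalGradient V η)) =
      compE η k (fun x => (jointFamily n k).score η x u * V x) -
        compE η k (fun x => (jointFamily n k).score η x u) * c := by
    have horth := hc k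
    have huw := ((hscore k u).mul (hscore k (naturalGradient V η))).integrable_natGauss_mul (hη k)
    have hu := ((hscore k u).integrable_natGauss_mul (hη k)).mul_const c
    have huV := ((hV k).base.moderateGrowth_mul (hscore k u)).integrable_natGauss_mul (hη k)
    simp only [compE, mul_sub, mul_add, ← mul_assoc] at horth huw hu huV ⊢
    rw [integral_sub (huw.fun_add hu) huV, integral_add huw hu, integral_mul_const] at horth
    linarith
  have hmean : ∑ k, weight η.odds k * compE η k (fun x => (jointFamily n k).score η x u) = 0 := by
    simpa only [integral_jointQ_mul] using sum_integral_jointQ_mul_score_apply hη u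
  simp only [dotProduct_approxFIM_mulVec hη, hsplit, mul_sub, ← mul_assoc, Finset.sum_sub_distrib,
    ← Finset.sum_mul, hmean, zero_mul, sub_zero]

theorem flowField_eq_neg_naturalGradient {d : ℕ} {prior : Vec n → ℝ} {lik : Vec d → Vec n → ℝ}
    {z : Vec d} (hη : η ∈ admissible n m)
    (hV : ∀ k, ExpIntegrableC2 (suff · (η.comp k)) V)
    (hderiv : ∀ v, fderiv ℝ (objective prior lik z) η v =
      ∑ k, weight η.odds k * compE η k fun x => (jointFamily n k).score η x v * V x) :
    flowField prior lik z η = -naturalGradient V η := by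
  have hpartials :
      partials (objective prior lik z) η = approxFIM η *ᵥ naturalGradient V η := by
    ext a
    rw [partials, hderiv, ← dotProduct_approxFIM_mulVec_naturalGradient hη hV,
      single_one_dotProduct]
  rw [flowField, hpartials, Matrix.mulVec_mulVec,
    Matrix.nonsing_inv_mul _ (approxFIM_posDef hη).det_pos.ne'.isUnit, Matrix.one_mulVec]

theorem hasDerivWithinAt_neg_naturalGradient_iff {d : ℕ} {prior : Vec n → ℝ}
    {lik : Vec d → Vec n → ℝ} {z : Vec d} {c : ℝ → MParam n m} {I : Set ℝ} {t : ℝ}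
    (hV : ContDiff ℝ 2 (kernelV prior lik z (c t))) :
    HasDerivWithinAt c (-naturalGradient (kernelV prior lik z (c t)) (c t)) I t ↔
      ∀ k, ComponentODE prior lik z c I t k := by
  set w := naturalGradient (kernelV prior lik z (c t)) (c t)
  have hGam (k : Fin (m + 1)) (i j : Fin n) : -(1 / 2 : ℝ) * compE (c t) k
      (fun x => hessian (kernelV prior lik z (c t)) x i j) = -(w.comp k).Gam i j := by
    rw [naturalGradient_comp, quadProjection_Gam _ hV, neg_mul, compE]
  have hodds (k : Fin (m + 1)) : compE (c t) (Fin.last m) (kernelV prior lik z (c t)) -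
      compE (c t) k (kernelV prior lik z (c t)) = -logOdds w.odds k := by
    rw [logOdds_naturalGradient_odds, neg_sub]
  simp only [ComponentODE, hGam, hodds, hasDerivWithinAt_pi]
  refine ⟨fun h k => ⟨fun i => h (.inl (.inl i, k)), fun i j => h (.inl (.inr _, k)), ?_⟩,
    fun h a => ?_⟩
  · refine Fin.lastCases ?_ (fun i => ?_) k
    · simpa only [logOdds, Fin.lastCases_last, neg_zero] using hasDerivWithinAt_const t I (0 : ℝ)
    · simpa only [logOdds, Fin.lastCases_castSucc] using! h (.inr i)
  · rcases a with ⟨i | ⟨⟨i, j⟩, hij⟩, k⟩ | i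
    · exact (h k).1 i
    · have hij : i ≤ j := hij
      simpa only [GParam.Gam, Matrix.of_apply, min_eq_left hij, max_eq_right hij] using!
        (h k).2.1 i j
    · simpa only [logOdds, Fin.lastCases_castSucc] using! (h i.castSucc).2.2

end NaturalGradient

end GMFlow

end

open GMFlow in
theorem mainTheorem4 {n m d : ℕ}
    (prior : Vec n → ℝ) (lik : Vec d → Vec n → ℝ) (z : Vec d)
    (hprior : ∀ x, 0 < prior x) (hlik : ∀ x, 0 < lik z x)
    (hsmooth : ContDiff ℝ 2 (jointP prior lik z))
    (hint : Integrable (jointP prior lik z) volume)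
    (Θ : Set (MParam n m)) (hopen : IsOpen Θ) (hadm : Θ ⊆ admissible n m)
    -- `log p(x, z)` and its first two derivatives have finite expectations under the components
    (hlog : ∀ η ∈ Θ, ∀ k,
      CompIntegrable η k (fun x => Real.log (jointP prior lik z x)) ∧
      (∀ i, CompIntegrable η k
        (fun x => gradient (fun y => Real.log (jointP prior lik z y)) x i)) ∧
      (∀ i j, CompIntegrable η k
        (fun x => hessian (fun y => Real.log (jointP prior lik z y)) x i j))) :
    -- the objects entering the flow and its component-wise form are well defined
    (∀ η ∈ Θ,
      (∀ a b, Integrable (fun y => jointQ η y *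
        (fderiv ℝ (fun η' => Real.log (jointQ η' y)) η (Pi.single a 1) *
          fderiv ℝ (fun η' => Real.log (jointQ η' y)) η (Pi.single b 1)))
        ((volume : Measure (Vec n)).prod Measure.count)) ∧
      (approxFIM η).PosDef ∧
      Integrable (klIntegrand (mixture η) (posterior prior lik z)) volume ∧
      DifferentiableAt ℝ (objective prior lik z) η ∧
      ContDiff ℝ 2 (kernelV prior lik z η) ∧
      (∀ k, CompIntegrable η k (kernelV prior lik z η) ∧
        (∀ i, CompIntegrable η k (fun x => gradient (kernelV prior lik z η) x i)) ∧
        (∀ i j, CompIntegrable η k (fun x => hessian (kernelV prior lik z η) x i j)))) ∧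
    -- the approximated Fisher information matrix is block diagonal
    (∀ η ∈ Θ, approxFIM η = Matrix.fromBlocks
      (Matrix.blockDiagonal fun k =>
        weight η.odds k • fisherInfo (volume : Measure (Vec n)) natGauss (η.comp k))
      0 0 (fisherInfo Measure.count weight η.odds)) ∧
    -- the flow equation is equivalent to the component-wise equations
    (∀ (c : ℝ → MParam n m) (I : Set ℝ) (t : ℝ), t ∈ I → c t ∈ Θ →
      (HasDerivWithinAt c (flowField prior lik z (c t)) I t ↔
        ∀ k, ComponentODE prior lik z c I t k)) := by
  have hp (x : Vec n) : 0 < jointP prior lik z x := mul_pos (hlik x) (hprior x)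
  have hreg {η : MParam n m} (hη : η ∈ Θ) (k : Fin (m + 1)) :=
    expIntegrableC2_of_compIntegrable hopen hadm (hsmooth.log fun x => (hp x).ne') hlog hη k
  have hcont {η : MParam n m} (hη : η ∈ Θ) := (hreg hη 0).contDiff.continuous
  have hV {η : MParam n m} (hη : η ∈ Θ) (k : Fin (m + 1)) :=
    expIntegrableC2_kernelV (hadm hη) (hreg hη k)
  refine ⟨fun η hη => ⟨fun a b => ?_, approxFIM_posDef (hadm hη), ?_, ?_, (hV hη 0).contDiff,
    fun k => compIntegrable_of_expIntegrableC2 (hadm hη) (hV hη k)⟩,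
    fun η hη => approxFIM_eq_fromBlocks (hadm hη), fun c I t _ hct => ?_⟩
  · exact integrable_jointQ_mul_fisherScore_mul_fisherScore (hadm hη) _ _
  · exact integrable_klIntegrand_posterior (hadm hη) hp hint (hcont hη) fun k => (hreg hη k).base
  · exact differentiableAt_objective (hadm hη) hp hint (hcont hη) fun k => (hreg hη k).base
  · rw [flowField_eq_neg_naturalGradient (hadm hct) (hV hct) (fderiv_objective_apply (hadm hct)
      hp hint (hcont hct) fun k => (hreg hct k).base)]
    exact hasDerivWithinAt_neg_naturalGradient_iff (hV hct 0).contDiff
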